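/- Let $\mathbb K$ be a field and $V$ a $\mathbb K$-vector space of finite positive dimension. A tridiagonal pair on $V$ is an ordered pair $A,A^*$ of diagonalizable elements of $\mathrm{End}(V)$ such that the eigenspaces of $A$ have an ordering $V_0,\dots,V_d$ with $A^*V_i\subseteq V_{i-1}+V_i+V_{i+1}$, the eigenspaces of $A^*$ have an ordering $V^*_0,\dots,V^*_\delta$ with $AV^*_i\subseteq V^*_{i-1}+V^*_i+V^*_{i+1}$ (terms with index out of range being $0$; such orderings are called standard), and no subspace $W\neq 0,V$ is invariant under both $A$ and $A^*$. A tridiagonal system $\Phi=(A;\{E_i\}_{i=0}^d;A^*;\{E^*_i\}_{i=0}^d)$ on $V$ consists of a tridiagonal pair $A,A^*$ together with the primitive idempotents $E_i$ of $A$ and $E_i^*$ of $A^*$ (the projections onto the eigenspaces along the sum of the others), both in a standard ordering. Let $\theta_i$ (resp. $\theta^*_i$) be the eigenvalue of $A$ on $E_iV$ (resp. of $A^*$ on $E^*_iV$). Put $\tau_i=\prod_{j=0}^{i-1}(\lambda-\theta_j)$, $\eta_i=\prod_{j=0}^{i-1}(\lambda-\theta_{d-j})$, and define $\tau^*_i,\eta^*_i$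 in the same way from the $\theta^*_j$. Put $\Phi^*=(A^*;\{E^*_i\};A;\{E_i\})$, $\Phi^{\downarrow}=(A;\{E_i\};A^*;\{E^*_{d-i}\})$, $\Phi^{\Downarrow}=(A;\{E_{d-i}\};A^*;\{E^*_i\})$; the relatives of $\Phi$ are the eight systems $\Phi,\Phi^\downarrow,\Phi^\Downarrow,\Phi^{\downarrow\Downarrow},\Phi^*,\Phi^{\downarrow*},\Phi^{\Downarrow*},\Phi^{\downarrow\Downarrow*}$. The system $\Phi$ is sharp if $\dim E_0V=1$. Let $U_0=E^*_0V\cap(E_0V+\cdots+E_dV)$. The split sequence $\{\zeta_i\}_{i=0}^d$ of a sharp $\Phi$ is defined by: $\zeta_i$ is the eigenvalue on $U_0$ of $(A^*-\theta^*_1I)\cdots(A^*-\theta^*_iI)(A-\theta_{i-1}I)\cdots(A-\theta_0I)$. The parameter array of $\Phi$ is $(\{\theta_i\};\{\theta^*_i\};\{\zeta_i\})$. Write $\zeta^\downarrow_i,\zeta^\Downarrow_i,\zeta^{\downarrow\Downarrow}_i$ for the split sequences of $\Phi^\downarrow,\Phi^\Downarrow,\Phi^{\downarrow\Downarrow}$.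 For a nonzero $q$ in a field $F$ and integers $r,s,t\ge 0$ define $[r,s,t]_q$ as follows, where $(a;q)_n=(1-a)(1-aq)\cdots(1-aq^{n-1})$: - if $q\ne\pm1$: $\displaystyle [r,s,t]_q=\frac{(q;q)_{r+s}(q;q)_{r+t}(q;q)_{s+t}}{(q;q)_r(q;q)_s(q;q)_t(q;q)_{r+s+t}}$; - if $q=1$, $\mathrm{char}\,F\ne2$: $\displaystyle [r,s,t]_q=\frac{(r+s)!\,(r+t)!\,(s+t)!}{r!\,s!\,t!\,(r+s+t)!}$; - if $q=-1$, $\mathrm{char}\,F\ne2$: $[r,s,t]_q=0$ if $r,s,t$ are all odd, and otherwise $\displaystyle [r,s,t]_q=\frac{\lfloor\frac{r+s}2\rfloor!\,\lfloor\frac{r+t}2\rfloor!\,\lfloor\frac{s+t}2\rfloor!}{\lfloor\frac r2\rfloor!\,\lfloor\frac s2\rfloor!\,\lfloor\frac t2\rfloor!\,\lfloor\frac{r+s+t}2\rfloor!}$; - if $q=1$, $\mathrm{char}\,F=2$: $[r,s,t]_q=0$ if $r=s=t=1$, and $1$ otherwise. **Theorem.** Let $\Phi$ be a sharp tridiagonal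 system on $V$. For each relative of $\Phi$ the space playing the role of $U_0$ has dimension $1$ and the split sequence is well defined. There is a nonzero $q$ in the algebraic closure $\overline{\mathbb K}$ such that $q+q^{-1}+1$ equals both $\frac{\theta_{i-2}-\theta_{i+1}}{\theta_{i-1}-\theta_i}$ and $\frac{\theta^*_{i-2}-\theta^*_{i+1}}{\theta^*_{i-1}-\theta^*_i}$ for all $2\le i\le d-1$. For every such $q$ (any nonzero $q$ if $d\le2$) the scalars $[r,s,t]_q$ with $r+s+t\le d$ lie in $\mathbb K$, and for $0\le i\le d$ the following hold. (i) $$\frac{\zeta_i^{\downarrow}}{(\theta_0-\theta_1)\cdots(\theta_0-\theta_i)}=\sum_{h=0}^i\frac{[h,i-h,d-i]_q\,\eta^*_{i-h}(\theta^*_0)\,\zeta_h}{(\theta_0-\theta_1)\cdots(\theta_0-\theta_h)},\qquad \frac{\zeta_i}{(\theta_0-\theta_1)\cdots(\theta_0-\theta_i)}=\sum_{h=0}^i\frac{[h,i-h,d-i]_q\,\tau^*_{i-h}(\theta^*_d)\,\zeta^\downarrow_h}{(\theta_0-\theta_1)\cdots(\theta_0-\theta_h)}.$$ (ii) $$\frac{\zeta_i^{\Downarrow}}{(\theta^*_0-\theta^*_1)\cdots(\theta^*_0-\theta^*_i)}=\sum_{h=0}^i\frac{[h,i-h,d-i]_q\,\eta_{i-h}(\theta_0)\,\zeta_h}{(\theta^*_0-\theta^*_1)\cdots(\theta^*_0-\theta^*_h)},\qquad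 \frac{\zeta_i}{(\theta^*_0-\theta^*_1)\cdots(\theta^*_0-\theta^*_i)}=\sum_{h=0}^i\frac{[h,i-h,d-i]_q\,\tau_{i-h}(\theta_d)\,\zeta^\Downarrow_h}{(\theta^*_0-\theta^*_1)\cdots(\theta^*_0-\theta^*_h)}.$$ (iii) $$\frac{\zeta_i^{\downarrow\Downarrow}}{(\theta^*_d-\theta^*_{d-1})\cdots(\theta^*_d-\theta^*_{d-i})}=\sum_{h=0}^i\frac{[h,i-h,d-i]_q\,\eta_{i-h}(\theta_0)\,\zeta^\downarrow_h}{(\theta^*_d-\theta^*_{d-1})\cdots(\theta^*_d-\theta^*_{d-h})},\qquad \frac{\zeta_i^{\downarrow}}{(\theta^*_d-\theta^*_{d-1})\cdots(\theta^*_d-\theta^*_{d-i})}=\sum_{h=0}^i\frac{[h,i-h,d-i]_q\,\tau_{i-h}(\theta_d)\,\zeta^{\downarrow\Downarrow}_h}{(\theta^*_d-\theta^*_{d-1})\cdots(\theta^*_d-\theta^*_{d-h})}.$$ (iv) $$\frac{\zeta_i^{\downarrow\Downarrow}}{(\theta_d-\theta_{d-1})\cdots(\theta_d-\theta_{d-i})}=\sum_{h=0}^i\frac{[h,i-h,d-i]_q\,\eta^*_{i-h}(\theta^*_0)\,\zeta^\Downarrow_h}{(\theta_d-\theta_{d-1})\cdots(\theta_d-\theta_{d-h})},\qquad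 \frac{\zeta_i^{\Downarrow}}{(\theta_d-\theta_{d-1})\cdots(\theta_d-\theta_{d-i})}=\sum_{h=0}^i\frac{[h,i-h,d-i]_q\,\tau^*_{i-h}(\theta^*_d)\,\zeta^{\downarrow\Downarrow}_h}{(\theta_d-\theta_{d-1})\cdots(\theta_d-\theta_{d-h})}.$$ Consequently the parameter array of $\Phi$ determines the split sequence of each relative: if $\Phi'$ is a sharp tridiagonal system over $\mathbb K$ (on a possibly different space) with the same parameter array as $\Phi$, then for each of the eight relatives the split sequence for $\Phi'$ equals that for $\Phi$. -/

import Mathlib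

open Polynomial

noncomputable section

/-! Tridiagonal pairs. -/

section Pairs

variable {K : Type*} {V : Type*} [Field K] [AddCommGroup V] [Module K V]

/-- `W` is an eigenspace of `A`: it is nonzero and of the form `{v | A v = θ v}`. -/
def IsEigenspace (A : Module.End K V) (W : Submodule K V) : Prop :=
  W ≠ ⊥ ∧ ∃ θ : K, W = Module.End.eigenspace A θ

/-- `V` is spanned by the eigenspaces of `A`. -/
def IsDiagonalizable (A : Module.End K V) : Prop :=
  ⨆ θ : K, Module.End.eigenspace A θ = ⊤

/-- `W 0, …, W d` is an ordering (without repetition) of all the eigenspaces of `A`. -/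
def IsEigenspaceOrdering {d : ℕ} (A : Module.End K V) (W : Fin (d + 1) → Submodule K V) : Prop :=
  Function.Injective W ∧ ∀ U : Submodule K V, IsEigenspace A U ↔ ∃ i, W i = U

/-- A standard ordering of the eigenspaces of `A`, relative to `B`:
`B (W i) ⊆ W (i - 1) + W i + W (i + 1)`, where `W (-1) = W (d + 1) = 0`. -/
def IsStandardOrdering {d : ℕ} (A B : Module.End K V) (W : Fin (d + 1) → Submodule K V) : Prop :=
  IsEigenspaceOrdering A W ∧
    ∀ i, (W i).map B ≤ ⨆ j : Fin (d + 1), ⨆ _ : (i : ℕ) ≤ j + 1 ∧ (j : ℕ) ≤ i + 1, W j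

/-- `A, As` is a tridiagonal pair on `V`. -/
structure IsTridiagonalPair (A As : Module.End K V) : Prop where
  diag : IsDiagonalizable A
  diag_star : IsDiagonalizable As
  standard : ∃ (d : ℕ) (W : Fin (d + 1) → Submodule K V), IsStandardOrdering A As W
  standard_star : ∃ (δ : ℕ) (W : Fin (δ + 1) → Submodule K V), IsStandardOrdering As A W
  irreducible : ∀ W : Submodule K V, W.map A ≤ W → W.map As ≤ W → W = ⊥ ∨ W = ⊤

/-- `E 0, …, E d` is a standard ordering of the primitive idempotents of `A` (relative to `B`):
for some standard ordering `W 0, …, W d` of the eigenspaces of `A`, `E i` is the projection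
that is the identity on `W i` and vanishes on `W j` for `j ≠ i`. -/
def IsStandardIdempotents {d : ℕ} (A B : Module.End K V) (E : Fin (d + 1) → Module.End K V) :
    Prop :=
  ∃ W : Fin (d + 1) → Submodule K V, IsStandardOrdering A B W ∧
    ∀ i, (∀ v ∈ W i, E i v = v) ∧ ∀ j, j ≠ i → ∀ v ∈ W j, E i v = 0

theorem IsTridiagonalPair.symm {A As : Module.End K V} (h : IsTridiagonalPair A As) :
    IsTridiagonalPair As A :=
  ⟨h.diag_star, h.diag, h.standard_star, h.standard, fun W h1 h2 => h.irreducible W h2 h1⟩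

theorem IsStandardIdempotents.rev {d : ℕ} {A B : Module.End K V}
    {E : Fin (d + 1) → Module.End K V} (h : IsStandardIdempotents A B E) :
    IsStandardIdempotents A B (fun i => E i.rev) := by
  obtain ⟨W, ⟨⟨hinj, hall⟩, htri⟩, hE⟩ := h
  refine ⟨fun i => W i.rev, ⟨⟨fun i j hij => Fin.rev_injective (hinj hij), fun U => ?_⟩,
    fun i => (htri i.rev).trans ?_⟩,
    fun i => ⟨(hE i.rev).1, fun j hj => (hE i.rev).2 j.rev (fun e => hj (Fin.rev_injective e))⟩⟩
  · rw [hall U]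
    exact ⟨fun ⟨i, hi⟩ => ⟨i.rev, by simpa using hi⟩, fun ⟨i, hi⟩ => ⟨i.rev, hi⟩⟩
  · refine iSup_le fun j => iSup_le fun hj => ?_
    refine le_iSup_of_le j.rev (le_iSup_of_le ?_ (by simp))
    simp only [Fin.val_rev] at hj ⊢
    omega

theorem IsStandardIdempotents.range_eq {d : ℕ} {A B : Module.End K V}
    {E : Fin (d + 1) → Module.End K V} (hA : IsDiagonalizable A)
    (h : IsStandardIdempotents A B E) (i : Fin (d + 1)) :
    ∃ θ : K, LinearMap.range (E i) = Module.End.eigenspace A θ := by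
  obtain ⟨W, ⟨⟨_, hall⟩, _⟩, hE⟩ := h
  obtain ⟨_, θ, hθ⟩ := (hall (W i)).2 ⟨i, rfl⟩
  refine ⟨θ, hθ ▸ le_antisymm ?_ fun v hv => ⟨v, (hE i).1 v hv⟩⟩
  rw [LinearMap.range_eq_map, ← hA, Submodule.map_iSup]
  refine iSup_le fun μ => ?_
  by_cases hμ : Module.End.eigenspace A μ = ⊥
  · simp [hμ]
  obtain ⟨j, hj⟩ := (hall _).1 ⟨hμ, μ, rfl⟩
  rintro _ ⟨v, hv, rfl⟩
  have hv : v ∈ W j := by rw [hj]; exact hv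
  by_cases hji : j = i
  · subst hji
    rwa [(hE j).1 v hv]
  · rw [(hE i).2 j hji v hv]
    exact zero_mem _

end Pairs

/-! Polynomials and products attached to a finite sequence of scalars. -/

section Scalars

variable {K : Type*} [Field K] {d : ℕ}

/-- `(λ - θ 0) (λ - θ 1) ⋯ (λ - θ (i - 1))`. -/
def tauPoly (θ : Fin (d + 1) → K) (i : ℕ) : K[X] :=
  ∏ j ∈ Finset.univ.filter (fun j : Fin (d + 1) => (j : ℕ) < i), (X - C (θ j))

/-- `(λ - θ d) (λ - θ (d - 1)) ⋯ (λ - θ (d - i + 1))`. -/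
def etaPoly (θ : Fin (d + 1) → K) (i : ℕ) : K[X] :=
  ∏ j ∈ Finset.univ.filter (fun j : Fin (d + 1) => d < (j : ℕ) + i), (X - C (θ j))

/-- `(θ 0 - θ 1) (θ 0 - θ 2) ⋯ (θ 0 - θ i)`. -/
def headProd (θ : Fin (d + 1) → K) (i : ℕ) : K :=
  ∏ j ∈ Finset.univ.filter (fun j : Fin (d + 1) => 0 < (j : ℕ) ∧ (j : ℕ) ≤ i), (θ 0 - θ j)

/-- `(θ d - θ (d - 1)) (θ d - θ (d - 2)) ⋯ (θ d - θ (d - i))`. -/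
def tailProd (θ : Fin (d + 1) → K) (i : ℕ) : K :=
  ∏ j ∈ Finset.univ.filter (fun j : Fin (d + 1) => (j : ℕ) < d ∧ d ≤ (j : ℕ) + i), (θ (Fin.last d) - θ j)

/-- `(a; q)_n = (1 - a) (1 - a q) ⋯ (1 - a q ^ (n - 1))`. -/
def qPochhammer (a q : K) (n : ℕ) : K :=
  ∏ k ∈ Finset.range n, (1 - a * q ^ k)

open Classical in
/-- The scalar `[r, s, t]_q`. The four cases are: `q ≠ ±1`; `q = 1` in characteristic `≠ 2`;
`q = -1` in characteristic `≠ 2`; `q = 1` in characteristic `2`. -/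
def qBracket (q : K) (r s t : ℕ) : K :=
  if q ≠ 1 ∧ q ≠ -1 then
    (qPochhammer q q (r + s) * qPochhammer q q (r + t) * qPochhammer q q (s + t)) /
      (qPochhammer q q r * qPochhammer q q s * qPochhammer q q t * qPochhammer q q (r + s + t))
  else if ringChar K ≠ 2 then
    if q = 1 then
      (((r + s).factorial : K) * ((r + t).factorial : K) * ((s + t).factorial : K)) /
        ((r.factorial : K) * (s.factorial : K) * (t.factorial : K) * ((r + s + t).factorial : K))
    else if Odd r ∧ Odd s ∧ Odd t then 0
    else
      ((((r + s) / 2).factorial : K) * (((r + t) / 2).factorial : K) *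
          (((s + t) / 2).factorial : K)) /
        (((r / 2).factorial : K) * ((s / 2).factorial : K) * ((t / 2).factorial : K) *
          (((r + s + t) / 2).factorial : K))
  else if r = 1 ∧ s = 1 ∧ t = 1 then 0
  else 1

end Scalars

/-! Tridiagonal systems. -/

/-- A tridiagonal system `(A; E 0, …, E d; As; Es 0, …, Es d)` on `V`. -/
structure TDSystem (K : Type*) (V : Type*) [Field K] [AddCommGroup V] [Module K V] (d : ℕ) where
  A : Module.End K V
  E : Fin (d + 1) → Module.End K V
  As : Module.End K V
  Es : Fin (d + 1) → Module.End K V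
  pair : IsTridiagonalPair A As
  standard : IsStandardIdempotents A As E
  standard_star : IsStandardIdempotents As A Es

namespace TDSystem

variable {K : Type*} {V : Type*} [Field K] [AddCommGroup V] [Module K V] {d : ℕ}

/-- `Φ^*`. -/
def star (Φ : TDSystem K V d) : TDSystem K V d where
  A := Φ.As
  E := Φ.Es
  As := Φ.A
  Es := Φ.E
  pair := Φ.pair.symm
  standard := Φ.standard_star
  standard_star := Φ.standard

/-- `Φ^↓`: the ordering of the `Es i` is reversed. -/
def down (Φ : TDSystem K V d) : TDSystem K V d where
  A := Φ.A
  E := Φ.E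
  As := Φ.As
  Es := fun i => Φ.Es i.rev
  pair := Φ.pair
  standard := Φ.standard
  standard_star := Φ.standard_star.rev

/-- `Φ^⇓`: the ordering of the `E i` is reversed. -/
def ddown (Φ : TDSystem K V d) : TDSystem K V d where
  A := Φ.A
  E := fun i => Φ.E i.rev
  As := Φ.As
  Es := Φ.Es
  pair := Φ.pair
  standard := Φ.standard.rev
  standard_star := Φ.standard_star

/-- The eight relatives of `Φ`: apply `↓` if `a`, then `⇓` if `b`, then `*` if `c`. -/
def relative (Φ : TDSystem K V d) (a b c : Bool) : TDSystem K V d :=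
  let Φ₁ := if a then Φ.down else Φ
  let Φ₂ := if b then Φ₁.ddown else Φ₁
  if c then Φ₂.star else Φ₂

/-- The eigenvalue of `A` associated with the eigenspace `E i V`. -/
def theta (Φ : TDSystem K V d) (i : Fin (d + 1)) : K :=
  (Φ.standard.range_eq Φ.pair.diag i).choose

/-- The eigenvalue of `As` associated with the eigenspace `Es i V`. -/
def thetaStar (Φ : TDSystem K V d) (i : Fin (d + 1)) : K :=
  (Φ.standard_star.range_eq Φ.pair.diag_star i).choose

/-- The shape: `ρ i = dim (E i V)`. -/
def shape (Φ : TDSystem K V d) (i : Fin (d + 1)) : ℕ :=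
  Module.finrank K (LinearMap.range (Φ.E i))

/-- `Φ` is sharp: `ρ 0 = 1`. -/
def IsSharp (Φ : TDSystem K V d) : Prop :=
  Φ.shape 0 = 1

/-- The split decomposition:
`U i = (Es 0 V + ⋯ + Es i V) ∩ (E i V + ⋯ + E d V)`. -/
def splitSpace (Φ : TDSystem K V d) (i : Fin (d + 1)) : Submodule K V :=
  (⨆ j : Fin (d + 1), ⨆ _ : j ≤ i, LinearMap.range (Φ.Es j)) ⊓
    (⨆ j : Fin (d + 1), ⨆ _ : i ≤ j, LinearMap.range (Φ.E j))

/-- `(As - θ*_1) ⋯ (As - θ*_i) (A - θ_{i-1}) ⋯ (A - θ_0)`. -/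
def splitOperator (Φ : TDSystem K V d) (i : Fin (d + 1)) : Module.End K V :=
  aeval Φ.As (∏ j ∈ Finset.univ.filter (fun j : Fin (d + 1) => 0 < (j : ℕ) ∧ j ≤ i),
      (X - C (Φ.thetaStar j))) *
    aeval Φ.A (tauPoly Φ.theta i)

/-- `z` is the eigenvalue of the `i`-th split operator on `U 0`. -/
def IsSplitEigenvalue (Φ : TDSystem K V d) (i : Fin (d + 1)) (z : K) : Prop :=
  ∀ u ∈ Φ.splitSpace 0, Φ.splitOperator i u = z • u

open Classical in
/-- The split sequence (meaningful when `Φ` is sharp). -/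
def splitSeq (Φ : TDSystem K V d) (i : Fin (d + 1)) : K :=
  if h : ∃ z, Φ.IsSplitEigenvalue i z then h.choose else 0

/-- The parameter array (meaningful when `Φ` is sharp). -/
def parameterArray (Φ : TDSystem K V d) :
    (Fin (d + 1) → K) × (Fin (d + 1) → K) × (Fin (d + 1) → K) :=
  (Φ.theta, Φ.thetaStar, Φ.splitSeq)

/-- `q` is a nonzero scalar in the algebraic closure of `K` such that `q + q⁻¹ + 1` is the common
value of `(θ_{i-2} - θ_{i+1}) / (θ_{i-1} - θ_i)` and `(θ*_{i-2} - θ*_{i+1}) / (θ*_{i-1} - θ*_i)`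
for `2 ≤ i ≤ d - 1` (no condition besides `q ≠ 0` if `d ≤ 2`). Here `i = k + 2`. -/
def IsBase (Φ : TDSystem K V d) (q : AlgebraicClosure K) : Prop :=
  q ≠ 0 ∧ ∀ (k : ℕ) (hk : k + 3 < d + 1),
    algebraMap K (AlgebraicClosure K)
        ((Φ.theta ⟨k, by omega⟩ - Φ.theta ⟨k + 3, hk⟩) /
          (Φ.theta ⟨k + 1, by omega⟩ - Φ.theta ⟨k + 2, by omega⟩)) = q + q⁻¹ + 1 ∧
    algebraMap K (AlgebraicClosure K)
        ((Φ.thetaStar ⟨k, by omega⟩ - Φ.thetaStar ⟨k + 3, hk⟩) /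
          (Φ.thetaStar ⟨k + 1, by omega⟩ - Φ.thetaStar ⟨k + 2, by omega⟩)) = q + q⁻¹ + 1

end TDSystem

end

/-! On the line $E^*_0V$, compressing $\tau_i(A)$ gives the scalar
$\zeta_i/((\theta^*_0-\theta^*_1)\cdots(\theta^*_0-\theta^*_i))$ (`IsSharp.Es_mul_tauPoly_mul_Es`).
Passing to $\Phi^{\Downarrow}$ replaces $\tau_i$ by $\eta_i$ and keeps $E^*_0$. So the first half of
(ii) is the compression of a polynomial identity, the expansion of $\eta_i$ in the Newton basis
$\tau_h$ (`etaPoly_eq_sum`). Its coefficients are $[h,i-h,d-i]_q\,\eta_{i-h}(\theta_0)$ because the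
brackets obey a Pascal type recursion along $\theta$ (`isPascalBracket_qBracket`).

All other relations follow by symmetry. The second half of (ii) is the first for
$\Phi^{\Downarrow}$. Part (i) is (ii) for $\Phi^*$, since $\Phi$ and $\Phi^*$ have the same split
sequence (`IsSharp.splitSeq_star`). Parts (iii) and (iv) are (ii) for $\Phi^{\downarrow}$ and (i)
for $\Phi^{\Downarrow}$.

Existence of $q$ requires that both eigenvalue sequences satisfy one and the same three-term
relation. Interpolation gives a polynomial $f$ with $A^2A^*A-AA^*A^2=[f(A),A^*]$. Comparing blocks
between the eigenspaces of $A^*$ shows that $\deg f\le 3$ and that the cubic coefficient governs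
$\theta^*$; divided differences show that it also governs $\theta$ (`exists_common_recurrence`). The
comparison needs certain corner blocks of $A^r$ to be nonzero (`Es_mul_pow_mul_Es_ne_zero`), which
comes from irreducibility through the split decomposition. -/

section Brackets

/-! ### Brackets $[r,s,t]_q$ and their Pascal type recursion -/

variable {F : Type*} [Field F]

/-- The generalized factorial `w 1 * w 2 * ⋯ * w n`. -/
def genFactorial (w : ℕ → F) (n : ℕ) : F := ∏ k ∈ Finset.range n, w (k + 1)

theorem genFactorial_succ (w : ℕ → F) (n : ℕ) :
    genFactorial w (n + 1) = genFactorial w n * w (n + 1) := by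
  simp [genFactorial, Finset.prod_range_succ]

theorem genFactorial_ne_zero {w : ℕ → F} {d n : ℕ} (hw : ∀ k, 1 ≤ k → k ≤ d → w k ≠ 0)
    (hn : n ≤ d) : genFactorial w n ≠ 0 :=
  Finset.prod_ne_zero_iff.2 fun k hk => hw _ (by omega) (by have := Finset.mem_range.1 hk; omega)

/-- The bracket built from a generalized factorial. -/
def genBracket (w : ℕ → F) (r s t : ℕ) : F :=
  (genFactorial w (r + s) * genFactorial w (r + t) * genFactorial w (s + t)) /
    (genFactorial w r * genFactorial w s * genFactorial w t * genFactorial w (r + s + t))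

theorem genBracket_zero_left {w : ℕ → F} {d s t : ℕ} (hw : ∀ k, 1 ≤ k → k ≤ d → w k ≠ 0)
    (h : s + t ≤ d) : genBracket w 0 s t = 1 := by
  have h0 : genFactorial w 0 = 1 := by simp [genFactorial]
  have h1 := genFactorial_ne_zero hw (n := s) (by omega)
  have h2 := genFactorial_ne_zero hw (n := t) (by omega)
  have h3 := genFactorial_ne_zero hw (n := s + t) (by omega)
  simp only [genBracket, zero_add, h0, one_mul]
  exact div_self (by positivity)

theorem genBracket_zero_mid {w : ℕ → F} {d r t : ℕ} (hw : ∀ k, 1 ≤ k → k ≤ d → w k ≠ 0)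
    (h : r + t ≤ d) : genBracket w r 0 t = 1 := by
  have h0 : genFactorial w 0 = 1 := by simp [genFactorial]
  have h1 := genFactorial_ne_zero hw (n := r) (by omega)
  have h2 := genFactorial_ne_zero hw (n := t) (by omega)
  have h3 := genFactorial_ne_zero hw (n := r + t) (by omega)
  simp only [genBracket, zero_add, add_zero, h0, mul_one]
  field_simp

/-- The three brackets share all but two factors each, so the recursion reduces to the identity
`hXY`. The multipliers `e₁`, `e₂`, `e₃` make room for the parity factors, equal to 0 or 1, that
occur when $q=-1$. -/
theorem genBracket_recursion {w : ℕ → F} {d r s t : ℕ} (hw : ∀ k, 1 ≤ k → k ≤ d → w k ≠ 0)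
    (h : r + s + t + 2 ≤ d) {e₁ e₂ e₃ X Y : F}
    (hXY : (e₁ * (w (r + s + 2) * w (t + 1)) - e₂ * (w (s + t + 2) * w (r + 1))) * X =
      e₃ * (w (r + t + 2) * w (s + 1)) * Y) :
    e₁ * genBracket w (r + 1) (s + 1) t * X =
      e₂ * genBracket w r (s + 1) (t + 1) * X + Y * (e₃ * genBracket w (r + 1) s (t + 1)) := by
  have hr := hw (r + 1) (by omega) (by omega)
  have hs := hw (s + 1) (by omega) (by omega)
  have ht := hw (t + 1) (by omega) (by omega)
  have h1 := genFactorial_ne_zero hw (n := r) (by omega)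
  have h2 := genFactorial_ne_zero hw (n := s) (by omega)
  have h3 := genFactorial_ne_zero hw (n := t) (by omega)
  have h4 := genFactorial_ne_zero hw (n := r + s + t + 2) (by omega)
  have e1 : r + 1 + (s + 1) = (r + s + 1) + 1 := by ring
  have e2 : r + 1 + t = r + t + 1 := by ring
  have e3 : s + 1 + t = s + t + 1 := by ring
  have e4 : r + s + 1 + 1 + t = r + s + t + 2 := by ring
  have e5 : r + (s + 1) = r + s + 1 := by ring
  have e6 : r + (t + 1) = r + t + 1 := by ring
  have e7 : s + 1 + (t + 1) = (s + t + 1) + 1 := by ring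
  have e8 : r + s + 1 + (t + 1) = r + s + t + 2 := by ring
  have e9 : r + 1 + s = r + s + 1 := by ring
  have e10 : r + 1 + (t + 1) = (r + t + 1) + 1 := by ring
  have e11 : s + (t + 1) = s + t + 1 := by ring
  simp only [genBracket, e1, e2, e3, e4, e5, e6, e7, e8, e9, e10, e11]
  rw [genFactorial_succ w (r + s + 1), genFactorial_succ w (s + t + 1),
    genFactorial_succ w (r + t + 1), genFactorial_succ w r, genFactorial_succ w s,
    genFactorial_succ w t]
  simp only [add_assoc, Nat.reduceAdd] at hXY h4 ⊢
  generalize genFactorial w (r + (s + 1)) = a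
  generalize genFactorial w (r + (t + 1)) = b
  generalize genFactorial w (s + (t + 1)) = c
  field_simp
  linear_combination a * b * c * hXY

/-- The scalars `θ 0, …, θ d` are distinct, and `(θ k - θ (k + 3)) = b (θ (k + 1) - θ (k + 2))`
whenever `k + 3 ≤ d`. -/
structure IsRecurrentSeq (d : ℕ) (b : F) (θ : ℕ → F) : Prop where
  inj : ∀ i j, i ≤ d → j ≤ d → θ i = θ j → i = j
  recur : ∀ k, k + 3 ≤ d → θ k - θ (k + 3) = b * (θ (k + 1) - θ (k + 2))

theorem eq_of_recurrence {d : ℕ} {b : F} {θ φ : ℕ → F}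
    (hθ : ∀ k, k + 3 ≤ d → θ k - θ (k + 3) = b * (θ (k + 1) - θ (k + 2)))
    (hφ : ∀ k, φ k - φ (k + 3) = b * (φ (k + 1) - φ (k + 2)))
    (h0 : θ 0 = φ 0) (h1 : θ 1 = φ 1) (h2 : θ 2 = φ 2) : ∀ i, i ≤ d → θ i = φ i := by
  intro i
  induction i using Nat.strong_induction_on with
  | _ i ih =>
    intro hi
    match i, ih, hi with
    | 0, _, _ => exact h0
    | 1, _, _ => exact h1
    | 2, _, _ => exact h2
    | k + 3, ih, hi =>
      have a0 := ih k (by omega) (by omega)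
      have a1 := ih (k + 1) (by omega) (by omega)
      have a2 := ih (k + 2) (by omega) (by omega)
      have := hθ k hi
      rw [a0, a1, a2, ← hφ k] at this
      exact sub_right_injective this

namespace IsRecurrentSeq

variable {d : ℕ} {q : F} {θ : ℕ → F}

/-- The characteristic polynomial of the recurrence is $(x-1)(x-q)(x-q^{-1})$, with distinct roots
here. The next two lemmas treat the triple root 1 and the double root $-1$. -/
theorem exists_geometric (hθ : IsRecurrentSeq d (q + q⁻¹ + 1) θ) (hq : q ≠ 0) (h1 : q ≠ 1)
    (h2 : q ≠ -1) : ∃ a b c : F, ∀ i, i ≤ d → θ i = a + b * q ^ i + c * q⁻¹ ^ i := by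
  have n1 : 1 - q ≠ 0 := sub_ne_zero.2 h1.symm
  have n2 : q ^ 2 - 1 ≠ 0 := by
    have : q ^ 2 - 1 = (q - 1) * (q + 1) := by ring
    rw [this]
    exact mul_ne_zero (sub_ne_zero.2 h1) fun h => h2 (eq_neg_of_add_eq_zero_left h)
  -- The values of `b` and `c` solve $\theta_0-\theta_1=(1-q)(b-cq^{-1})$ and
  -- $\theta_1-\theta_2=(1-q)(bq-cq^{-2})$.
  obtain ⟨b, hb⟩ : ∃ b, b = ((θ 1 - θ 2) * q - (θ 0 - θ 1)) / ((1 - q) * (q ^ 2 - 1)) := ⟨_, rfl⟩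
  obtain ⟨c, hc⟩ : ∃ c, c = q * (b - (θ 0 - θ 1) / (1 - q)) := ⟨_, rfl⟩
  refine ⟨θ 0 - b - c, b, c, eq_of_recurrence hθ.recur (fun k => ?_) ?_ ?_ ?_⟩
  · simp only [pow_succ]
    field_simp
    ring
  · ring
  · rw [hc]
    field_simp
    ring
  · have hb' : b * ((1 - q) * (q ^ 2 - 1)) = (θ 1 - θ 2) * q - (θ 0 - θ 1) := by
      rw [hb, div_mul_cancel₀ _ (mul_ne_zero n1 n2)]
    rw [hc]
    field_simp
    linear_combination (1 - q) * hb'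

theorem exists_quadratic (hθ : IsRecurrentSeq d (1 + 1⁻¹ + 1) θ) (h2 : (2 : F) ≠ 0) :
    ∃ a b c : F, ∀ i, i ≤ d → θ i = a + b * i + c * i ^ 2 := by
  refine ⟨θ 0, θ 1 - θ 0 - (θ 2 - 2 * θ 1 + θ 0) / 2, (θ 2 - 2 * θ 1 + θ 0) / 2,
    eq_of_recurrence hθ.recur (fun k => ?_) ?_ ?_ ?_⟩
  · push_cast
    ring
  · simp
  · push_cast
    ring
  · push_cast
    field_simp
    ring

theorem exists_alternating (hθ : IsRecurrentSeq d (-1 + (-1)⁻¹ + 1) θ) (h2 : (2 : F) ≠ 0) :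
    ∃ a b c : F, ∀ i, i ≤ d → θ i = a + (-1) ^ i * (b + c * i) := by
  obtain ⟨c, hc⟩ : ∃ c, c = (θ 2 - θ 0) / 2 := ⟨_, rfl⟩
  obtain ⟨a, ha⟩ : ∃ a, a = (θ 0 + θ 1 + c) / 2 := ⟨_, rfl⟩
  refine ⟨a, θ 0 - a, c, eq_of_recurrence hθ.recur (fun k => ?_) ?_ ?_ ?_⟩
  · push_cast
    have : (-1 : F)⁻¹ = -1 := by norm_num
    rw [this]
    ring
  · simp
  · rw [ha]
    push_cast
    field_simp
    ring
  · rw [hc]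
    push_cast
    field_simp
    ring

theorem sub_ne_zero (hθ : IsRecurrentSeq d q θ) {i j : ℕ} (hi : i ≤ d) (hj : j ≤ d) (h : i ≠ j) :
    θ i - θ j ≠ 0 :=
  _root_.sub_ne_zero.2 fun e => h (hθ.inj i j hi hj e)

end IsRecurrentSeq

theorem qPochhammer_eq_genFactorial (q : F) (n : ℕ) :
    qPochhammer q q n = genFactorial (fun k => 1 - q ^ k) n := by
  simp [qPochhammer, genFactorial, pow_succ, mul_comm]

theorem factorial_eq_genFactorial (n : ℕ) :
    (n.factorial : F) = genFactorial (fun k => (k : F)) n := by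
  induction n with
  | zero => simp [genFactorial]
  | succ n ih => rw [genFactorial_succ, ← ih, Nat.factorial_succ]; push_cast; ring

theorem half_factorial_eq_genFactorial (n : ℕ) :
    ((n / 2).factorial : F) =
      genFactorial (fun k => if Even k then ((k / 2 : ℕ) : F) else 1) n := by
  induction n with
  | zero => simp [genFactorial]
  | succ n ih =>
    rw [genFactorial_succ, ← ih]
    split_ifs with h
    · have : (n + 1) / 2 = n / 2 + 1 := by obtain ⟨m, hm⟩ := h; omega
      rw [this, Nat.factorial_succ]
      push_cast
      ring
    · have : (n + 1) / 2 = n / 2 := by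
        rw [Nat.not_even_iff_odd] at h; obtain ⟨m, hm⟩ := h; omega
      rw [this, mul_one]

/-- The bracket `[r, s, t]_q` has the value `1` when `r = 0` or `s = 0`, and satisfies a
Pascal type recursion governed by `θ`. -/
structure IsPascalBracket (d : ℕ) (θ : ℕ → F) (B : ℕ → ℕ → ℕ → F) : Prop where
  zero_left : ∀ s t, s + t ≤ d → B 0 s t = 1
  zero_mid : ∀ r t, r + t ≤ d → B r 0 t = 1
  recursion : ∀ r s t, r + s + t + 2 ≤ d →
    B (r + 1) (s + 1) t * (θ 0 - θ (r + t + 2)) =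
      B r (s + 1) (t + 1) * (θ 0 - θ (r + t + 2)) +
        (θ (r + 1) - θ (t + 1)) * B (r + 1) s (t + 1)

variable {d : ℕ} {q : F} {θ : ℕ → F}

theorem isPascalBracket_of_generic (hθ : IsRecurrentSeq d (q + q⁻¹ + 1) θ) (hq : q ≠ 0)
    (h1 : q ≠ 1) (h2 : q ≠ -1) : IsPascalBracket d θ (qBracket q) := by
  obtain ⟨a, b, c, habc⟩ := hθ.exists_geometric hq h1 h2
  have hB : qBracket q = genBracket (fun k => 1 - q ^ k) := by
    funext r s t
    rw [qBracket, if_pos ⟨h1, h2⟩]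
    simp only [qPochhammer_eq_genFactorial, genBracket]
  -- If $q^k=1$, the closed form gives $\theta_k=\theta_0$; distinctness of the $\theta_i$ is what
  -- makes the denominators nonzero.
  have hw : ∀ k, 1 ≤ k → k ≤ d → 1 - q ^ k ≠ 0 := fun k hk hkd h0 => by
    refine hθ.sub_ne_zero (Nat.zero_le d) hkd (by omega) ?_
    have : q ^ k = 1 := (sub_eq_zero.1 h0).symm
    rw [habc 0 (Nat.zero_le d), habc k hkd]
    simp [this]
  rw [hB]
  refine ⟨fun s t h => genBracket_zero_left hw h, fun r t h => genBracket_zero_mid hw h,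
    fun r s t h => ?_⟩
  have := genBracket_recursion (e₁ := 1) (e₂ := 1) (e₃ := 1) hw h
    (X := θ 0 - θ (r + t + 2)) (Y := θ (r + 1) - θ (t + 1)) ?_
  · simpa using this
  · rw [habc 0 (by omega), habc _ (by omega : r + t + 2 ≤ d), habc _ (by omega : r + 1 ≤ d),
      habc _ (by omega : t + 1 ≤ d)]
    simp only [pow_add, inv_pow]
    field_simp
    ring

theorem isPascalBracket_of_one (hθ : IsRecurrentSeq d (1 + 1⁻¹ + 1) θ) (h2 : ringChar F ≠ 2) :
    IsPascalBracket d θ (qBracket 1) := by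
  have h2' : (2 : F) ≠ 0 := Ring.two_ne_zero h2
  obtain ⟨a, b, c, habc⟩ := hθ.exists_quadratic h2'
  have hB : qBracket (1 : F) = genBracket (fun k => (k : F)) := by
    funext r s t
    rw [qBracket, if_neg (by simp), if_pos h2, if_pos rfl]
    simp only [factorial_eq_genFactorial, genBracket]
  have hw : ∀ k, 1 ≤ k → k ≤ d → (k : F) ≠ 0 := fun k hk hkd h0 => by
    refine hθ.sub_ne_zero (Nat.zero_le d) hkd (by omega) ?_
    rw [habc 0 (Nat.zero_le d), habc k hkd, h0]
    simp
  rw [hB]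
  refine ⟨fun s t h => genBracket_zero_left hw h, fun r t h => genBracket_zero_mid hw h,
    fun r s t h => ?_⟩
  have := genBracket_recursion (e₁ := 1) (e₂ := 1) (e₃ := 1) hw h
    (X := θ 0 - θ (r + t + 2)) (Y := θ (r + 1) - θ (t + 1)) ?_
  · simpa using this
  · rw [habc 0 (by omega), habc _ (by omega : r + t + 2 ≤ d), habc _ (by omega : r + 1 ≤ d),
      habc _ (by omega : t + 1 ≤ d)]
    push_cast
    ring

theorem isPascalBracket_of_neg_one (hθ : IsRecurrentSeq d (-1 + (-1)⁻¹ + 1) θ)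
    (h2 : ringChar F ≠ 2) : IsPascalBracket d θ (qBracket (-1)) := by
  have h2' : (2 : F) ≠ 0 := Ring.two_ne_zero h2
  obtain ⟨a, b, c, habc⟩ := hθ.exists_alternating h2'
  set w : ℕ → F := fun k => if Even k then ((k / 2 : ℕ) : F) else 1 with hw_def
  -- The factorials of halves form a generalized factorial in which odd steps contribute 1; the
  -- exceptional zero is split off as a separate factor.
  have hB : ∀ r s t, qBracket (-1 : F) r s t =
      (if Odd r ∧ Odd s ∧ Odd t then 0 else 1) * genBracket w r s t := by
    intro r s t
    have h1 : (-1 : F) ≠ 1 := Ring.neg_one_ne_one_of_char_ne_two h2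
    rw [qBracket, if_neg (by simp), if_pos h2, if_neg h1]
    simp only [half_factorial_eq_genFactorial, genBracket]
    split_ifs <;> simp [w]
  have hw : ∀ k, 1 ≤ k → k ≤ d → w k ≠ 0 := fun k hk hkd h0 => by
    simp only [w] at h0
    split_ifs at h0 with hk2
    · refine hθ.sub_ne_zero (Nat.zero_le d) hkd (by omega) ?_
      obtain ⟨m, rfl⟩ := hk2
      rw [show (m + m) / 2 = m by omega] at h0
      rw [habc 0 (Nat.zero_le d), habc _ hkd]
      push_cast
      rw [h0]
      simp
    · exact one_ne_zero h0
  refine ⟨fun s t h => ?_, fun r t h => ?_, fun r s t h => ?_⟩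
  · simp [hB, genBracket_zero_left hw h]
  · simp [hB, genBracket_zero_mid hw h]
  · simp only [hB]
    refine genBracket_recursion hw h ?_
    rw [habc 0 (by omega), habc _ (by omega : r + t + 2 ≤ d), habc _ (by omega : r + 1 ≤ d),
      habc _ (by omega : t + 1 ≤ d)]
    simp only [w]
    have hd2 : ∀ m : ℕ, Even m → ((m / 2 : ℕ) : F) = m / 2 := fun m hm => by
      obtain ⟨n, rfl⟩ := hm
      rw [show (n + n) / 2 = n by omega]
      push_cast
      field_simp
      ring
    -- Once the parities of $r,s,t$ are fixed, all signs and all values of `w` are explicit and the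
    -- identity is polynomial.
    rcases Nat.even_or_odd r with hr | hr <;> rcases Nat.even_or_odd s with hs | hs <;>
      rcases Nat.even_or_odd t with ht | ht
    all_goals
      have hr' := hr
      have hs' := hs
      have ht' := ht
      try simp only [← Nat.not_even_iff_odd] at hr' hs' ht'
      have hpr : (-1 : F) ^ r = _ := hr.neg_one_pow
      have hpt : (-1 : F) ^ t = _ := ht.neg_one_pow
      simp [pow_add, hpr, hpt, Nat.even_add, Nat.even_add_one, ← Nat.not_even_iff_odd, hr', hs', ht']
    all_goals try
      repeat rw [hd2 _ (by simp [Nat.even_add, Nat.even_add_one, hr', hs', ht'])]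
      push_cast
      field_simp
      ring

theorem isPascalBracket_of_char_two (hθ : IsRecurrentSeq d (1 + 1⁻¹ + 1) θ)
    (h2 : ringChar F = 2) : IsPascalBracket d θ (qBracket 1) := by
  have hF : (2 : F) = 0 := by
    have := ringChar.Nat.cast_ringChar (R := F)
    rw [h2] at this
    exact_mod_cast this
  have hB : ∀ r s t, qBracket (1 : F) r s t = if r = 1 ∧ s = 1 ∧ t = 1 then 0 else 1 := by
    intro r s t
    rw [qBracket, if_neg (by simp), if_neg (by simpa using h2)]
  -- In characteristic 2 with $q=1$ the recurrence has period 4, so $\theta_4=\theta_0$ would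
  -- contradict distinctness. Only a few triples $(r,s,t)$ remain.
  have hd : d ≤ 3 := by
    by_contra! hd
    refine hθ.sub_ne_zero (i := 0) (j := 4) (by omega) (by omega) (by omega) ?_
    have a := hθ.recur 0 (by omega)
    have b := hθ.recur 1 (by omega)
    norm_num at a b
    linear_combination a + b + hF * (θ 1 - θ 3)
  refine ⟨fun s t _ => by simp [hB], fun r t _ => by simp [hB], fun r s t h => ?_⟩
  simp only [hB]
  have : (r = 0 ∧ t = 0) ∨ (r = 1 ∧ s = 0 ∧ t = 0) ∨ (r = 0 ∧ s = 0 ∧ t = 1) := by omega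
  rcases this with ⟨rfl, rfl⟩ | ⟨rfl, rfl, rfl⟩ | ⟨rfl, rfl, rfl⟩
  · simp
  · have a := hθ.recur 0 (by omega)
    norm_num at a ⊢
    linear_combination a + hF * (2 * (θ 1 - θ 2))
  · have a := hθ.recur 0 (by omega)
    norm_num at a ⊢
    linear_combination a + hF * (θ 1 - θ 2 + θ 3 - θ 0)

theorem isPascalBracket_qBracket (hθ : IsRecurrentSeq d (q + q⁻¹ + 1) θ) (hq : q ≠ 0) :
    IsPascalBracket d θ (qBracket q) := by
  by_cases h : q ≠ 1 ∧ q ≠ -1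
  · exact isPascalBracket_of_generic hθ hq h.1 h.2
  by_cases h2 : ringChar F = 2
  · have hF : (2 : F) = 0 := by
      have := ringChar.Nat.cast_ringChar (R := F)
      rw [h2] at this
      exact_mod_cast this
    obtain rfl : q = 1 := by
      by_contra h1
      exact h ⟨h1, fun e => h1 (by rw [e]; linear_combination -hF)⟩
    exact isPascalBracket_of_char_two hθ h2
  · by_cases h1 : q = 1
    · subst h1
      exact isPascalBracket_of_one hθ h2
    · obtain rfl : q = -1 := by
        by_contra h3
        exact h ⟨h1, h3⟩
      exact isPascalBracket_of_neg_one hθ h2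

end Brackets

/-! ### Newton expansions in the polynomials $\tau_i$ and $\eta_i$ -/

section Newton

/-- A finite sequence as a function on `ℕ` (only the values at `n ≤ d` matter). -/
def seqExt {K : Type*} {d : ℕ} (θ : Fin (d + 1) → K) (n : ℕ) : K := θ (Fin.ofNat (d + 1) n)

theorem seqExt_val {K : Type*} {d : ℕ} (θ : Fin (d + 1) → K) (i : Fin (d + 1)) : seqExt θ i = θ i := by
  simp [seqExt]

theorem seqExt_of_lt {K : Type*} {d : ℕ} (θ : Fin (d + 1) → K) {n : ℕ} (hn : n < d + 1) :
    seqExt θ n = θ ⟨n, hn⟩ :=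
  seqExt_val θ ⟨n, hn⟩

theorem seqExt_rev {K : Type*} {d : ℕ} (θ : Fin (d + 1) → K) {n : ℕ} (hn : n ≤ d) :
    seqExt (fun i => θ i.rev) n = seqExt θ (d - n) := by
  rw [seqExt_of_lt _ (by omega : n < d + 1), seqExt_of_lt _ (by omega : d - n < d + 1)]
  congr 1
  ext
  simp

variable {K : Type*} [Field K] {d : ℕ}

theorem tauPoly_zero (θ : Fin (d + 1) → K) : tauPoly θ 0 = 1 := by
  simp [tauPoly]

theorem etaPoly_zero (θ : Fin (d + 1) → K) : etaPoly θ 0 = 1 :=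
  Finset.prod_eq_one fun j hj => by simp at hj; omega

theorem tauPoly_succ (θ : Fin (d + 1) → K) {i : ℕ} (hi : i ≤ d) :
    tauPoly θ (i + 1) = tauPoly θ i * (X - C (seqExt θ i)) := by
  have : Finset.univ.filter (fun j : Fin (d + 1) => (j : ℕ) < i + 1) =
      insert ⟨i, by omega⟩ (Finset.univ.filter (fun j : Fin (d + 1) => (j : ℕ) < i)) := by
    ext j
    simp only [Finset.mem_filter, Finset.mem_univ, true_and, Finset.mem_insert, Fin.ext_iff]
    omega
  rw [tauPoly, tauPoly, this, Finset.prod_insert (by simp), seqExt_of_lt θ (by omega), mul_comm]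

theorem etaPoly_rev (θ : Fin (d + 1) → K) (i : ℕ) :
    etaPoly (fun j => θ j.rev) i = tauPoly θ i := by
  refine Finset.prod_bij' (fun j _ => j.rev) (fun j _ => j.rev) ?_ ?_ ?_ ?_ ?_
  · intro j hj
    simp only [Finset.mem_filter, Finset.mem_univ, true_and, Fin.val_rev] at hj ⊢
    omega
  · intro j hj
    simp only [Finset.mem_filter, Finset.mem_univ, true_and, Fin.val_rev] at hj ⊢
    omega
  all_goals simp

theorem tauPoly_rev (θ : Fin (d + 1) → K) (i : ℕ) :
    tauPoly (fun j => θ j.rev) i = etaPoly θ i := by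
  rw [← etaPoly_rev]
  simp

theorem headProd_rev (θ : Fin (d + 1) → K) (i : ℕ) :
    headProd (fun j => θ j.rev) i = tailProd θ i := by
  refine Finset.prod_bij' (fun j _ => j.rev) (fun j _ => j.rev) ?_ ?_ ?_ ?_ ?_
  · intro j hj
    simp only [Finset.mem_filter, Finset.mem_univ, true_and, Fin.val_rev] at hj ⊢
    omega
  · intro j hj
    simp only [Finset.mem_filter, Finset.mem_univ, true_and, Fin.val_rev] at hj ⊢
    omega
  all_goals simp

theorem etaPoly_succ (θ : Fin (d + 1) → K) {i : ℕ} (hi : i ≤ d) :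
    etaPoly θ (i + 1) = etaPoly θ i * (X - C (seqExt θ (d - i))) := by
  rw [← tauPoly_rev, tauPoly_succ _ hi, tauPoly_rev, seqExt_rev _ hi]

theorem headProd_ne_zero {θ : Fin (d + 1) → K} (hθ : Function.Injective θ) (i : ℕ) :
    headProd θ i ≠ 0 := by
  refine Finset.prod_ne_zero_iff.2 fun j hj => sub_ne_zero.2 fun e => ?_
  have := hθ e
  subst this
  simp at hj

theorem headProd_succ (θ : Fin (d + 1) → K) {i : ℕ} (hi : i + 1 ≤ d) :
    headProd θ (i + 1) = headProd θ i * (θ 0 - seqExt θ (i + 1)) := by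
  have : Finset.univ.filter (fun j : Fin (d + 1) => 0 < (j : ℕ) ∧ (j : ℕ) ≤ i + 1) =
      insert ⟨i + 1, by omega⟩
        (Finset.univ.filter (fun j : Fin (d + 1) => 0 < (j : ℕ) ∧ (j : ℕ) ≤ i)) := by
    ext j
    simp only [Finset.mem_filter, Finset.mem_univ, true_and, Finset.mem_insert, Fin.ext_iff]
    omega
  rw [headProd, headProd, this, Finset.prod_insert (by simp), seqExt_of_lt θ (by omega), mul_comm]

/-- The expansion of `η i` in the basis `τ 0, τ 1, …`. -/
theorem etaPoly_eq_sum {θ : Fin (d + 1) → K} {B : ℕ → ℕ → ℕ → K}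
    (hB : IsPascalBracket d (seqExt θ) B) (hθ : Function.Injective θ) {i : ℕ} (hi : i ≤ d) :
    etaPoly θ i = ∑ h ∈ Finset.range (i + 1),
      C (B h (i - h) (d - i) * (etaPoly θ (i - h)).eval (θ 0)) * tauPoly θ h := by
  have h0 : seqExt θ 0 = θ 0 := seqExt_val θ 0
  induction i with
  | zero => simp [etaPoly_zero, tauPoly_zero, hB.zero_left]
  | succ i ih =>
    obtain ⟨t, rfl⟩ : ∃ t, d = i + 1 + t := ⟨d - (i + 1), by omega⟩
    have e1 : i + 1 + t - i = t + 1 := by omega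
    have e2 : i + 1 + t - (i + 1) = t := by omega
    rw [etaPoly_succ θ (by omega), ih (by omega), e1, e2]
    set c : ℕ → K := fun h => B h (i - h) (t + 1) * (etaPoly θ (i - h)).eval (θ 0) with hc
    set c' : ℕ → K := fun h => B h (i + 1 - h) t * (etaPoly θ (i + 1 - h)).eval (θ 0) with hc'
    change (∑ h ∈ Finset.range (i + 1), C (c h) * tauPoly θ h) * _ =
      ∑ h ∈ Finset.range (i + 1 + 1), C (c' h) * tauPoly θ h
    have hfirst : c' 0 = (seqExt θ 0 - seqExt θ (t + 1)) * c 0 := by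
      simp only [hc, hc', Nat.sub_zero]
      rw [hB.zero_left _ _ (by omega), hB.zero_left _ _ (by omega), etaPoly_succ θ (by omega), e1]
      simp [h0, mul_comm]
    have hlast : c' (i + 1) = c i := by
      simp only [hc, hc', Nat.sub_self]
      rw [hB.zero_mid _ _ (by omega), hB.zero_mid _ _ (by omega)]
    -- This is the Pascal recursion multiplied by $\eta_s(\theta_0)$, with $s=i-h-1$: the extra
    -- factor $\theta_0-\theta_{h+t+2}$ is the one by which $\eta_{s+1}(\theta_0)$ exceeds
    -- $\eta_s(\theta_0)$.
    have hmid : ∀ h ∈ Finset.range i,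
        c' (h + 1) = c h + (seqExt θ (h + 1) - seqExt θ (t + 1)) * c (h + 1) := by
      intro h hh
      obtain ⟨s, rfl⟩ : ∃ s, i = h + 1 + s :=
        ⟨i - (h + 1), by have := Finset.mem_range.1 hh; omega⟩
      simp only [hc, hc']
      rw [show h + 1 + s + 1 - (h + 1) = s + 1 by omega, show h + 1 + s - h = s + 1 by omega,
        show h + 1 + s - (h + 1) = s by omega, etaPoly_succ θ (by omega),
        show h + 1 + s + 1 + t - s = h + t + 2 by omega]
      have := hB.recursion h s t (by omega)
      simp only [eval_mul, eval_sub, eval_X, eval_C, ← h0]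
      linear_combination (eval (seqExt θ 0) (etaPoly θ s)) * this
    -- Here $\eta_{i+1}=\eta_i\,(\lambda-\theta_{t+1})$, and writing
    -- $\lambda-\theta_{t+1}=(\lambda-\theta_h)+(\theta_h-\theta_{t+1})$ keeps the product in the
    -- Newton basis.
    have hstep : ∀ h ∈ Finset.range (i + 1),
        C (c h) * tauPoly θ h * (X - C (seqExt θ (t + 1))) = C (c h) * tauPoly θ (h + 1) +
          C ((seqExt θ h - seqExt θ (t + 1)) * c h) * tauPoly θ h := by
      intro h hh
      rw [tauPoly_succ θ (by have := Finset.mem_range.1 hh; omega)]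
      simp only [C_mul, C_sub]
      ring
    have hsum : ∑ h ∈ Finset.range i, C (c' (h + 1)) * tauPoly θ (h + 1) =
        ∑ h ∈ Finset.range i, (C (c h) * tauPoly θ (h + 1) +
          C ((seqExt θ (h + 1) - seqExt θ (t + 1)) * c (h + 1)) * tauPoly θ (h + 1)) :=
      Finset.sum_congr rfl fun h hh => by rw [hmid h hh, C_add, add_mul]
    rw [Finset.sum_mul, Finset.sum_congr rfl hstep, Finset.sum_add_distrib,
      Finset.sum_range_succ, Finset.sum_range_succ' _ i, Finset.sum_range_succ _ (i + 1),
      Finset.sum_range_succ' _ i, hfirst, hlast,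
      hsum, Finset.sum_add_distrib]
    ring

/-- `(λ - θ 1) ⋯ (λ - θ i)`. -/
noncomputable def shiftedTauPoly (θ : Fin (d + 1) → K) (i : ℕ) : K[X] :=
  ∏ j ∈ Finset.univ.filter (fun j : Fin (d + 1) => 0 < (j : ℕ) ∧ (j : ℕ) ≤ i), (X - C (θ j))

theorem shiftedTauPoly_zero (θ : Fin (d + 1) → K) : shiftedTauPoly θ 0 = 1 :=
  Finset.prod_eq_one fun j hj => by
    have := (Finset.mem_filter.1 hj).2
    omega

theorem headProd_zero (θ : Fin (d + 1) → K) : headProd θ 0 = 1 :=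
  Finset.prod_eq_one fun j hj => by
    have := (Finset.mem_filter.1 hj).2
    omega

theorem X_sub_C_mul_shiftedTauPoly (θ : Fin (d + 1) → K) (i : ℕ) :
    (X - C (θ 0)) * shiftedTauPoly θ i = tauPoly θ (i + 1) := by
  have : Finset.univ.filter (fun j : Fin (d + 1) => (j : ℕ) < i + 1) = insert 0
      (Finset.univ.filter (fun j : Fin (d + 1) => 0 < (j : ℕ) ∧ (j : ℕ) ≤ i)) := by
    ext j
    simp only [Finset.mem_filter, Finset.mem_univ, true_and, Finset.mem_insert, Fin.ext_iff,
      Fin.val_zero]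
    omega
  rw [tauPoly, this, Finset.prod_insert (by simp), shiftedTauPoly]

theorem shiftedTauPoly_eval_zero (θ : Fin (d + 1) → K) (i : ℕ) :
    (shiftedTauPoly θ i).eval (θ 0) = headProd θ i := by
  simp [shiftedTauPoly, headProd, eval_prod]

theorem shiftedTauPoly_eval_eq_zero (θ : Fin (d + 1) → K) {i : ℕ} {j : Fin (d + 1)}
    (h0 : 0 < (j : ℕ)) (h : (j : ℕ) ≤ i) : (shiftedTauPoly θ i).eval (θ j) = 0 := by
  rw [shiftedTauPoly, eval_prod]
  exact Finset.prod_eq_zero (i := j) (Finset.mem_filter.2 ⟨Finset.mem_univ _, h0, h⟩) (by simp)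

theorem shiftedTauPoly_monic (θ : Fin (d + 1) → K) (i : ℕ) : (shiftedTauPoly θ i).Monic :=
  monic_prod_of_monic _ _ fun _ _ => monic_X_sub_C _

/-- The right side is the Lagrange polynomial at $\theta_0$ for the nodes $\theta_0,\dots,\theta_n$,
written in Newton form. For $n=d$, evaluation at $A$ yields $E_0$. -/
theorem sum_tauPoly_div_headProd {θ : Fin (d + 1) → K} (hθ : Function.Injective θ) {n : ℕ}
    (hn : n ≤ d) : ∑ j ∈ Finset.range (n + 1), C (headProd θ j)⁻¹ * tauPoly θ j =
      C (headProd θ n)⁻¹ * shiftedTauPoly θ n := by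
  induction n with
  | zero => simp [shiftedTauPoly_zero, tauPoly_zero, headProd_zero]
  | succ n ih =>
    have hX : (X - C (θ 0)) ≠ 0 := X_sub_C_ne_zero _
    refine mul_left_cancel₀ hX ?_
    rw [Finset.sum_range_succ, mul_add, ih (by omega), headProd_succ θ hn]
    have h1 := headProd_ne_zero hθ n
    have h2 := headProd_ne_zero hθ (n + 1)
    rw [headProd_succ θ hn] at h2
    have h3 := right_ne_zero_of_mul h2
    have h4 : C (headProd θ n)⁻¹ = (C (headProd θ n * (θ 0 - seqExt θ (n + 1)))⁻¹ : K[X]) *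
        (C (θ 0) - C (seqExt θ (n + 1))) := by
      rw [← C_sub, ← C_mul]
      congr 1
      field_simp
    linear_combination (-C (headProd θ n)⁻¹) * (X_sub_C_mul_shiftedTauPoly θ n).symm +
      C (headProd θ n * (θ 0 - seqExt θ (n + 1)))⁻¹ * ((X_sub_C_mul_shiftedTauPoly θ (n + 1)).symm - tauPoly_succ θ hn) +
      tauPoly θ (n + 1) * h4

theorem tauPoly_monic (θ : Fin (d + 1) → K) (i : ℕ) : (tauPoly θ i).Monic :=
  monic_prod_of_monic _ _ fun _ _ => monic_X_sub_C _

theorem tauPoly_natDegree (θ : Fin (d + 1) → K) {i : ℕ} (hi : i ≤ d + 1) :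
    (tauPoly θ i).natDegree = i := by
  rw [tauPoly, natDegree_prod_of_monic _ _ fun _ _ => monic_X_sub_C _]
  simp only [natDegree_X_sub_C, Finset.sum_const, smul_eq_mul, mul_one]
  have : (Finset.univ.filter (fun j : Fin (d + 1) => (j : ℕ) < i)).map Fin.valEmbedding =
      Finset.range i := by
    ext j
    simp only [Finset.mem_map, Finset.mem_filter, Finset.mem_univ, true_and,
      Fin.valEmbedding_apply, Finset.mem_range]
    exact ⟨fun ⟨a, ha, h⟩ => h ▸ ha, fun h => ⟨⟨j, by omega⟩, h, rfl⟩⟩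
  rw [← Finset.card_map, this, Finset.card_range]

theorem tauPoly_eval_eq_zero (θ : Fin (d + 1) → K) {i : ℕ} {j : Fin (d + 1)} (h : (j : ℕ) < i) :
    (tauPoly θ i).eval (θ j) = 0 := by
  rw [tauPoly, eval_prod]
  exact Finset.prod_eq_zero (i := j) (by simpa using h) (by simp)

theorem natDegree_tauPoly_sub_shiftedTauPoly (θ : Fin (d + 1) → K) {i : ℕ} (hi : i ≤ d)
    (h0 : 0 < i) : (tauPoly θ i - shiftedTauPoly θ i).natDegree < i := by
  have h1 := congrArg natDegree (X_sub_C_mul_shiftedTauPoly θ i)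
  rw [(monic_X_sub_C _).natDegree_mul (shiftedTauPoly_monic θ i), natDegree_X_sub_C,
    tauPoly_natDegree θ (by omega)] at h1
  have h2 := tauPoly_natDegree θ (i := i) (by omega)
  have hdeg : (tauPoly θ i).degree = (shiftedTauPoly θ i).degree := by
    rw [degree_eq_natDegree (tauPoly_monic θ i).ne_zero,
      degree_eq_natDegree (shiftedTauPoly_monic θ i).ne_zero]
    congr 1
    omega
  have h3 := degree_sub_lt_left hdeg (tauPoly_monic θ i).ne_zero
    (by rw [(tauPoly_monic θ i).leadingCoeff, (shiftedTauPoly_monic θ i).leadingCoeff])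
  rw [degree_eq_natDegree (tauPoly_monic θ i).ne_zero, h2] at h3
  by_cases hz : tauPoly θ i - shiftedTauPoly θ i = 0
  · rwa [hz, natDegree_zero]
  · exact (natDegree_lt_iff_degree_lt hz).2 h3

end Newton

/-! ### Descent of the brackets to the base field; reversal of sequences -/

section Descent

variable {K F : Type*} [Field K] [Field F] [Algebra K F] {d : ℕ}

/-- The bracket takes values in the field generated by the sequence. -/
theorem IsPascalBracket.exists_algebraMap_eq {θ : ℕ → K} {B : ℕ → ℕ → ℕ → F}
    (hB : IsPascalBracket d (fun n => algebraMap K F (θ n)) B)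
    (hθ : ∀ i j, i ≤ d → j ≤ d → θ i = θ j → i = j) (r s t : ℕ) (h : r + s + t ≤ d) :
    ∃ x : K, algebraMap K F x = B r s t := by
  induction r generalizing s t with
  | zero => exact ⟨1, by rw [hB.zero_left _ _ (by omega), map_one]⟩
  | succ r ihr =>
    induction s generalizing t with
    | zero => exact ⟨1, by rw [hB.zero_mid _ _ (by omega), map_one]⟩
    | succ s ihs =>
      obtain ⟨x, hx⟩ := ihr (s + 1) (t + 1) (by omega)
      obtain ⟨y, hy⟩ := ihs (t + 1) (by omega)
      -- The recursion can be solved for the new bracket inside $\mathbb K$ because this coefficient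
      -- is invertible.
      have h0 : θ 0 - θ (r + t + 2) ≠ 0 := sub_ne_zero.2 fun e => by
        have := hθ _ _ (by omega) (by omega) e
        omega
      have h0' : algebraMap K F (θ 0) - algebraMap K F (θ (r + t + 2)) ≠ 0 := by
        rw [← map_sub]
        exact (_root_.map_ne_zero _).2 h0
      refine ⟨x + (θ (r + 1) - θ (t + 1)) / (θ 0 - θ (r + t + 2)) * y,
        mul_right_cancel₀ h0' ?_⟩
      rw [hB.recursion r s t (by omega), ← hx, ← hy]
      simp only [map_add, map_mul, map_div₀, map_sub]
      field_simp

theorem IsPascalBracket.of_algebraMap {θ : ℕ → K} {B : ℕ → ℕ → ℕ → F} {b : ℕ → ℕ → ℕ → K}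
    (hB : IsPascalBracket d (fun n => algebraMap K F (θ n)) B)
    (hb : ∀ r s t, r + s + t ≤ d → algebraMap K F (b r s t) = B r s t) :
    IsPascalBracket d θ b := by
  refine ⟨fun s t h => ?_, fun r t h => ?_, fun r s t h => ?_⟩ <;>
    apply (algebraMap K F).injective
  · rw [hb _ _ _ (by omega), hB.zero_left _ _ h, map_one]
  · rw [hb _ _ _ (by omega), hB.zero_mid _ _ h, map_one]
  · simp only [map_add, map_mul, map_sub]
    rw [hb _ _ _ (by omega), hb _ _ _ (by omega), hb _ _ _ (by omega), hB.recursion _ _ _ h]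

theorem isRecurrentSeq_seqExt {θ : Fin (d + 1) → K} (hθ : Function.Injective θ) {b : F}
    (h : ∀ (k : ℕ) (hk : k + 3 < d + 1),
      algebraMap K F ((θ ⟨k, by omega⟩ - θ ⟨k + 3, hk⟩) /
        (θ ⟨k + 1, by omega⟩ - θ ⟨k + 2, by omega⟩)) = b) :
    IsRecurrentSeq d b (fun n => algebraMap K F (seqExt θ n)) := by
  refine ⟨fun i j hi hj e => ?_, fun k hk => ?_⟩
  · have := (algebraMap K F).injective e
    rw [seqExt_of_lt θ (by omega : i < d + 1), seqExt_of_lt θ (by omega : j < d + 1)] at this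
    simpa using hθ this
  · rw [seqExt_of_lt θ (by omega : k < d + 1), seqExt_of_lt θ (by omega : k + 3 < d + 1),
      seqExt_of_lt θ (by omega : k + 1 < d + 1), seqExt_of_lt θ (by omega : k + 2 < d + 1),
      ← h k (by omega), ← map_sub, ← map_sub, ← map_mul, div_mul_cancel₀]
    exact sub_ne_zero.2 fun e => by simpa using hθ e

/-- The recurrence is invariant under reversal with the same constant, so the same brackets serve
for $\Phi$ and for $\Phi^{\Downarrow}$. -/
theorem IsRecurrentSeq.rev {θ : Fin (d + 1) → K} {b : F}
    (h : IsRecurrentSeq d b (fun n => algebraMap K F (seqExt θ n))) :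
    IsRecurrentSeq d b (fun n => algebraMap K F (seqExt (fun i => θ i.rev) n)) := by
  refine ⟨fun i j hi hj e => ?_, fun k hk => ?_⟩
  · rw [seqExt_rev θ hi, seqExt_rev θ hj] at e
    have := h.inj _ _ (by omega) (by omega) e
    omega
  · rw [seqExt_rev θ (by omega : k ≤ d), seqExt_rev θ hk, seqExt_rev θ (by omega : k + 1 ≤ d),
      seqExt_rev θ (by omega : k + 2 ≤ d)]
    have := h.recur (d - (k + 3)) (by omega)
    rw [show d - (k + 3) + 3 = d - k by omega, show d - (k + 3) + 1 = d - (k + 2) by omega,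
      show d - (k + 3) + 2 = d - (k + 1) by omega] at this
    linear_combination -this

theorem sum_Iic_eq_sum_range {M : Type*} [AddCommMonoid M] (f : ℕ → M) (i : Fin (d + 1)) :
    ∑ h ∈ Finset.Iic i, f h = ∑ h ∈ Finset.range (i + 1), f h := by
  rw [Nat.range_succ_eq_Iic, ← Fin.map_valEmbedding_Iic, Finset.sum_map]
  rfl

end Descent

namespace TDSystem

variable {K : Type*} {V : Type*} [Field K] [AddCommGroup V] [Module K V] {d : ℕ}

/-! ### Primitive idempotents and block calculus -/

section Idempotents

variable (Φ : TDSystem K V d)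

theorem range_E (i : Fin (d + 1)) :
    LinearMap.range (Φ.E i) = Module.End.eigenspace Φ.A (Φ.theta i) :=
  (Φ.standard.range_eq Φ.pair.diag i).choose_spec

theorem exists_ordering : ∃ W : Fin (d + 1) → Submodule K V, IsStandardOrdering Φ.A Φ.As W ∧
    (∀ i, (∀ v ∈ W i, Φ.E i v = v) ∧ ∀ j, j ≠ i → ∀ v ∈ W j, Φ.E i v = 0) ∧
    ∀ i, W i = Module.End.eigenspace Φ.A (Φ.theta i) := by
  obtain ⟨W, hW, hE⟩ := Φ.standard
  refine ⟨W, hW, hE, fun i => ?_⟩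
  obtain ⟨hne, μ, hμ⟩ := (hW.1.2 (W i)).2 ⟨i, rfl⟩
  obtain ⟨v, hv, hv0⟩ := (Submodule.ne_bot_iff _).1 hne
  have h1 : v ∈ Module.End.eigenspace Φ.A (Φ.theta i) := by
    rw [← Φ.range_E i]
    exact ⟨v, (hE i).1 v hv⟩
  have h2 : v ∈ Module.End.eigenspace Φ.A μ := hμ ▸ hv
  rw [Module.End.mem_eigenspace_iff] at h1 h2
  -- The eigenvalue `theta` was obtained by choice; a common nonzero eigenvector identifies it with
  -- the eigenvalue of `W i`.
  rw [hμ, smul_left_injective K hv0 (h1.symm.trans h2)]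

theorem E_apply_of_mem {i : Fin (d + 1)} {v : V}
    (hv : v ∈ Module.End.eigenspace Φ.A (Φ.theta i)) : Φ.E i v = v := by
  obtain ⟨W, _, hE, hW⟩ := Φ.exists_ordering
  exact (hE i).1 v (hW i ▸ hv)

theorem E_apply_of_mem_ne {i j : Fin (d + 1)} (hij : j ≠ i) {v : V}
    (hv : v ∈ Module.End.eigenspace Φ.A (Φ.theta j)) : Φ.E i v = 0 := by
  obtain ⟨W, _, hE, hW⟩ := Φ.exists_ordering
  exact (hE i).2 j hij v (hW j ▸ hv)

theorem theta_injective : Function.Injective Φ.theta := by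
  obtain ⟨W, hstd, _, hW⟩ := Φ.exists_ordering
  exact fun i j hij => hstd.1.1 (by rw [hW, hW, hij])

theorem thetaStar_injective : Function.Injective Φ.thetaStar := Φ.star.theta_injective

theorem E_ne_zero (i : Fin (d + 1)) : Φ.E i ≠ 0 := by
  obtain ⟨W, hstd, hE, hW⟩ := Φ.exists_ordering
  obtain ⟨hne, -⟩ := (hstd.1.2 (W i)).2 ⟨i, rfl⟩
  obtain ⟨v, hv, hv0⟩ := (Submodule.ne_bot_iff _).1 hne
  exact fun h0 => hv0 (by rw [← (hE i).1 v hv, h0, LinearMap.zero_apply])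

theorem iSup_eigenspace : ⨆ i, Module.End.eigenspace Φ.A (Φ.theta i) = ⊤ := by
  obtain ⟨W, hstd, _, hW⟩ := Φ.exists_ordering
  rw [eq_top_iff, ← Φ.pair.diag]
  refine iSup_le fun μ => ?_
  by_cases hμ : Module.End.eigenspace Φ.A μ = ⊥
  · simp [hμ]
  · obtain ⟨j, hj⟩ := (hstd.1.2 _).1 ⟨hμ, μ, rfl⟩
    rw [← hj, hW j]
    exact le_iSup (fun i => Module.End.eigenspace Φ.A (Φ.theta i)) j

theorem ext_eigenspace {X Y : Module.End K V}
    (h : ∀ i, ∀ v ∈ Module.End.eigenspace Φ.A (Φ.theta i), X v = Y v) : X = Y := by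
  have : ⊤ ≤ LinearMap.eqLocus X Y := by
    rw [← Φ.iSup_eigenspace]
    exact iSup_le fun i v hv => h i v hv
  exact LinearMap.ext fun v => this trivial

theorem sum_E : ∑ i, Φ.E i = 1 := by
  refine Φ.ext_eigenspace fun j v hv => ?_
  rw [LinearMap.sum_apply, Finset.sum_eq_single j, Φ.E_apply_of_mem hv]
  · rfl
  · exact fun i _ hi => Φ.E_apply_of_mem_ne (Ne.symm hi) hv
  · simp

theorem E_apply_mem (i : Fin (d + 1)) (v : V) :
    Φ.E i v ∈ Module.End.eigenspace Φ.A (Φ.theta i) := by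
  rw [← Φ.range_E]
  exact ⟨v, rfl⟩

theorem E_mul_self (i : Fin (d + 1)) : Φ.E i * Φ.E i = Φ.E i :=
  LinearMap.ext fun v => Φ.E_apply_of_mem (Φ.E_apply_mem i v)

theorem E_mul_of_ne {i j : Fin (d + 1)} (h : i ≠ j) : Φ.E i * Φ.E j = 0 :=
  LinearMap.ext fun v => Φ.E_apply_of_mem_ne h.symm (Φ.E_apply_mem j v)

theorem A_mul_E (i : Fin (d + 1)) : Φ.A * Φ.E i = Φ.theta i • Φ.E i :=
  LinearMap.ext fun v => Module.End.mem_eigenspace_iff.1 (Φ.E_apply_mem i v)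

theorem E_mul_A (i : Fin (d + 1)) : Φ.E i * Φ.A = Φ.theta i • Φ.E i := by
  refine Φ.ext_eigenspace fun j v hv => ?_
  have hv' := Module.End.mem_eigenspace_iff.1 hv
  rw [Module.End.mul_apply, hv', map_smul, LinearMap.smul_apply]
  by_cases h : j = i
  · rw [h]
  · rw [Φ.E_apply_of_mem_ne h hv, smul_zero, smul_zero]

theorem aeval_mul_E (f : K[X]) (i : Fin (d + 1)) :
    aeval Φ.A f * Φ.E i = f.eval (Φ.theta i) • Φ.E i := by
  induction f using Polynomial.induction_on' with
  | add p q hp hq => simp [add_mul, hp, hq, add_smul]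
  | monomial n a =>
    rw [aeval_monomial, eval_monomial, mul_smul, Algebra.algebraMap_eq_smul_one, smul_mul_assoc,
      one_mul, smul_mul_assoc]
    congr 1
    induction n with
    | zero => simp
    | succ n ih => rw [pow_succ, mul_assoc, A_mul_E, mul_smul_comm, ih, smul_smul, pow_succ']

theorem E_mul_aeval (f : K[X]) (i : Fin (d + 1)) :
    Φ.E i * aeval Φ.A f = f.eval (Φ.theta i) • Φ.E i := by
  induction f using Polynomial.induction_on' with
  | add p q hp hq => simp [mul_add, hp, hq, add_smul]
  | monomial n a =>
    rw [aeval_monomial, eval_monomial, mul_smul, Algebra.algebraMap_eq_smul_one, smul_mul_assoc,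
      one_mul, mul_smul_comm]
    congr 1
    induction n with
    | zero => simp
    | succ n ih => rw [pow_succ', ← mul_assoc, E_mul_A, smul_mul_assoc, ih, smul_smul, pow_succ']

theorem E_mul_aeval_apply (f : K[X]) (i : Fin (d + 1)) (v : V) :
    Φ.E i (aeval Φ.A f v) = f.eval (Φ.theta i) • Φ.E i v :=
  LinearMap.congr_fun (Φ.E_mul_aeval f i) v

theorem E_mul_As_mul_E {i j : Fin (d + 1)} (h : (j : ℕ) + 1 < i ∨ (i : ℕ) + 1 < j) :
    Φ.E i * Φ.As * Φ.E j = 0 := by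
  obtain ⟨W, hstd, hE, hW⟩ := Φ.exists_ordering
  refine LinearMap.ext fun v => ?_
  have hv : Φ.As (Φ.E j v) ∈ (W j).map Φ.As :=
    Submodule.mem_map_of_mem (by rw [hW]; exact Φ.E_apply_mem j v)
  have hker : (⨆ k : Fin (d + 1), ⨆ _ : (j : ℕ) ≤ k + 1 ∧ (k : ℕ) ≤ j + 1, W k) ≤
      LinearMap.ker (Φ.E i) :=
    iSup_le fun k => iSup_le fun hk w hw => (hE i).2 k (by rintro rfl; omega) w hw
  exact hker (hstd.2 j hv)

theorem sum_mul_E (X : Module.End K V) : ∑ i, X * Φ.E i = X := by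
  rw [← Finset.mul_sum, sum_E, mul_one]

theorem ext_E {X Y : Module.End K V} (h : ∀ i j, Φ.E i * X * Φ.E j = Φ.E i * Y * Φ.E j) :
    X = Y := by
  have key : ∀ Z : Module.End K V, Z = ∑ i, ∑ j, Φ.E i * Z * Φ.E j := fun Z => by
    simp only [← Finset.mul_sum, ← Finset.sum_mul, sum_E, one_mul, mul_one]
  rw [key X, key Y]
  simp only [h]

theorem E_mul_mul_mul_E (X Y : Module.End K V) (i j : Fin (d + 1)) :
    Φ.E i * (X * Y) * Φ.E j = ∑ k, (Φ.E i * X * Φ.E k) * (Φ.E k * Y * Φ.E j) := by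
  have : ∀ k, (Φ.E i * X * Φ.E k) * (Φ.E k * Y * Φ.E j) = Φ.E i * X * (Φ.E k * (Y * Φ.E j)) :=
    fun k => by
      rw [mul_assoc _ (Φ.E k), ← mul_assoc (Φ.E k), ← mul_assoc (Φ.E k), E_mul_self]
      simp only [mul_assoc]
  rw [Finset.sum_congr rfl fun k _ => this k, ← Finset.mul_sum, ← Finset.sum_mul, sum_E, one_mul]
  simp only [mul_assoc]

theorem E_mul_pow_mul_E (k : ℕ) {i j : Fin (d + 1)} (h : (j : ℕ) + k < i ∨ (i : ℕ) + k < j) :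
    Φ.E i * Φ.As ^ k * Φ.E j = 0 := by
  induction k generalizing j with
  | zero =>
    rw [pow_zero, mul_one, Φ.E_mul_of_ne]
    rintro rfl
    omega
  | succ k ih =>
    rw [pow_succ, E_mul_mul_mul_E]
    refine Finset.sum_eq_zero fun l _ => ?_
    by_cases hl : (j : ℕ) + 1 < l ∨ (l : ℕ) + 1 < j
    · rw [Φ.E_mul_As_mul_E hl, mul_zero]
    · rw [ih (by omega), zero_mul]

theorem E_mul_aeval_As_mul_E (f : K[X]) {i j : Fin (d + 1)}
    (h : (j : ℕ) + f.natDegree < i ∨ (i : ℕ) + f.natDegree < j) :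
    Φ.E i * aeval Φ.As f * Φ.E j = 0 := by
  rw [aeval_eq_sum_range, Finset.mul_sum, Finset.sum_mul]
  refine Finset.sum_eq_zero fun k hk => ?_
  have := Finset.mem_range.1 hk
  rw [mul_smul_comm, smul_mul_assoc, Φ.E_mul_pow_mul_E k (by omega), smul_zero]

/-- Only the coefficient of `X ^ n` contributes to a block at distance `n` from the diagonal. -/
theorem E_mul_aeval_As_mul_E_of_dist (f : K[X]) {n : ℕ} (hf : f.natDegree ≤ n) {i j : Fin (d + 1)}
    (h : (j : ℕ) + n = i ∨ (i : ℕ) + n = j) :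
    Φ.E i * aeval Φ.As f * Φ.E j = f.coeff n • (Φ.E i * Φ.As ^ n * Φ.E j) := by
  rw [aeval_eq_sum_range' (Nat.lt_succ_of_le hf), Finset.mul_sum, Finset.sum_mul,
    Finset.sum_eq_single n]
  · rw [mul_smul_comm, smul_mul_assoc]
  · intro k hk hkn
    have := Finset.mem_range.1 hk
    rw [mul_smul_comm, smul_mul_assoc, Φ.E_mul_pow_mul_E k (by omega), smul_zero]
  · simp

theorem eq_bot_or_top_of_invariant (W : Submodule K V) (h : ∀ v ∈ W, Φ.A v ∈ W)
    (hs : ∀ v ∈ W, Φ.As v ∈ W) : W = ⊥ ∨ W = ⊤ :=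
  Φ.pair.irreducible W (Submodule.map_le_iff_le_comap.2 h) (Submodule.map_le_iff_le_comap.2 hs)

end Idempotents

/-! ### The two flags and the split decomposition -/

section Split

variable (Φ : TDSystem K V d)

/-- `E n V + ⋯ + E d V`. -/
def upper (n : ℕ) : Submodule K V :=
  ⨅ k : Fin (d + 1), ⨅ _ : (k : ℕ) < n, LinearMap.ker (Φ.E k)

/-- `Es 0 V + ⋯ + Es n V`. -/
def lower (n : ℕ) : Submodule K V :=
  ⨅ k : Fin (d + 1), ⨅ _ : n < (k : ℕ), LinearMap.ker (Φ.Es k)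

variable {Φ}

theorem mem_upper {n : ℕ} {v : V} : v ∈ Φ.upper n ↔ ∀ k : Fin (d + 1), (k : ℕ) < n → Φ.E k v = 0 := by
  simp [upper, Submodule.mem_iInf]

theorem mem_lower {n : ℕ} {v : V} : v ∈ Φ.lower n ↔ ∀ k : Fin (d + 1), n < (k : ℕ) → Φ.Es k v = 0 := by
  simp [lower, Submodule.mem_iInf]

variable (Φ)

theorem eq_sum_E_apply (v : V) : v = ∑ i, Φ.E i v := by
  rw [← LinearMap.sum_apply, sum_E, Module.End.one_apply]

theorem eq_zero_of_mem_upper {n : ℕ} (hn : d < n) {v : V} (hv : v ∈ Φ.upper n) : v = 0 := by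
  rw [Φ.eq_sum_E_apply v]
  exact Finset.sum_eq_zero fun i _ => mem_upper.1 hv i (by omega)

theorem mem_lower_zero {v : V} : v ∈ Φ.lower 0 ↔ Φ.Es 0 v = v := by
  rw [mem_lower]
  constructor
  · intro h
    conv_rhs => rw [Φ.star.eq_sum_E_apply v]
    rw [Finset.sum_eq_single 0]
    · rfl
    · exact fun i _ hi => h i (Nat.pos_of_ne_zero fun h0 => hi (Fin.ext h0))
    · simp
  · intro h k hk
    rw [← h]
    exact LinearMap.congr_fun (Φ.star.E_mul_of_ne (i := k) (j := 0) (by rintro rfl; simp at hk)) v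

theorem sub_smul_mem_upper {n : ℕ} {v : V} (hv : v ∈ Φ.upper n) :
    Φ.A v - seqExt Φ.theta n • v ∈ Φ.upper (n + 1) := by
  rw [mem_upper] at hv ⊢
  intro k hk
  have h1 : Φ.E k (Φ.A v) = Φ.theta k • Φ.E k v := LinearMap.congr_fun (Φ.E_mul_A k) v
  rw [map_sub, map_smul, h1, ← sub_smul]
  rcases Nat.lt_succ_iff_lt_or_eq.1 hk with h | h
  · rw [hv k h, smul_zero]
  · rw [← h, seqExt_val, sub_self, zero_smul]

theorem As_mem_upper {n m : ℕ} (hnm : m + 1 ≤ n) {v : V} (hv : v ∈ Φ.upper n) :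
    Φ.As v ∈ Φ.upper m := by
  rw [mem_upper] at hv ⊢
  intro k hk
  rw [Φ.eq_sum_E_apply v, map_sum, map_sum]
  refine Finset.sum_eq_zero fun i _ => ?_
  by_cases hi : (i : ℕ) < n
  · rw [hv i hi, map_zero, map_zero]
  · exact LinearMap.congr_fun (Φ.E_mul_As_mul_E (i := k) (j := i) (by omega)) v

theorem A_mem_lower {n : ℕ} {v : V} (hv : v ∈ Φ.lower n) : Φ.A v ∈ Φ.lower (n + 1) := by
  rw [mem_lower] at hv ⊢
  intro k hk
  rw [Φ.star.eq_sum_E_apply v, map_sum, map_sum]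
  refine Finset.sum_eq_zero fun i _ => ?_
  change Φ.Es k (Φ.A (Φ.Es i v)) = 0
  by_cases hi : n < (i : ℕ)
  · rw [hv i hi, map_zero, map_zero]
  · exact LinearMap.congr_fun (Φ.star.E_mul_As_mul_E (i := k) (j := i) (by omega)) v

theorem Es_apply_As (k : Fin (d + 1)) (v : V) : Φ.Es k (Φ.As v) = Φ.thetaStar k • Φ.Es k v :=
  LinearMap.congr_fun (Φ.star.E_mul_A k) v

theorem sub_smul_mem_lower {n : ℕ} {v : V} (hv : v ∈ Φ.lower (n + 1)) :
    Φ.As v - seqExt Φ.thetaStar (n + 1) • v ∈ Φ.lower n := by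
  rw [mem_lower] at hv ⊢
  intro k hk
  rw [map_sub, map_smul, Es_apply_As, ← sub_smul]
  rcases Nat.lt_or_eq_of_le (Nat.succ_le_of_lt hk) with h | h
  · rw [hv k h, smul_zero]
  · rw [show n + 1 = (k : ℕ) from h, seqExt_val, sub_self, zero_smul]

theorem As_apply_of_mem_lower_zero {v : V} (hv : v ∈ Φ.lower 0) :
    Φ.As v = Φ.thetaStar 0 • v := by
  have h := (Φ.mem_lower_zero).1 hv
  rw [← h]
  exact LinearMap.congr_fun (Φ.star.A_mul_E 0) v

theorem upper_ne_top {n : ℕ} (hn : 0 < n) : Φ.upper n ≠ ⊤ := fun h =>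
  Φ.E_ne_zero 0 (LinearMap.ext fun v => mem_upper.1 (h ▸ trivial : v ∈ Φ.upper n) 0 hn)

theorem lower_ne_top {n : ℕ} (hn : n < d) : Φ.lower n ≠ ⊤ := fun h =>
  Φ.star.E_ne_zero (Fin.last d) (LinearMap.ext fun v =>
    mem_lower.1 (h ▸ trivial : v ∈ Φ.lower n) (Fin.last d) hn)

theorem upper_antitone : Antitone Φ.upper := fun _ _ h _ hv =>
  mem_upper.2 fun k hk => mem_upper.1 hv k (hk.trans_le h)

theorem lower_monotone : Monotone Φ.lower := fun _ _ h _ hv =>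
  mem_lower.2 fun k hk => mem_lower.1 hv k (h.trans_lt hk)

/-- A family of intersections of the two flags spans an invariant subspace, provided it is
closed under raising and lowering. -/
theorem iSup_inf_eq_bot_or_top (m N : ℕ)
    (hN : ∀ r, r + 1 = N → ∀ v ∈ Φ.lower (r + 1) ⊓ Φ.upper (r + 1 + m), v = 0) :
    (⨆ r : ℕ, ⨆ _ : r < N, Φ.lower r ⊓ Φ.upper (r + m)) = ⊥ ∨
      (⨆ r : ℕ, ⨆ _ : r < N, Φ.lower r ⊓ Φ.upper (r + m)) = ⊤ := by
  set W := ⨆ r : ℕ, ⨆ _ : r < N, Φ.lower r ⊓ Φ.upper (r + m) with hW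
  have hle : ∀ r, r < N → Φ.lower r ⊓ Φ.upper (r + m) ≤ W := fun r hr =>
    le_iSup_of_le r (le_iSup_of_le hr le_rfl)
  refine Φ.eq_bot_or_top_of_invariant W ?_ ?_
  · have : W ≤ W.comap Φ.A := by
      refine iSup_le fun r => iSup_le fun hr v hv => ?_
      -- $A-\theta_{r+m}$ raises both flag indices by one, and below $A^*-\theta^*_{r+1}$ lowers
      -- them. Only raising can leave the family, at $r+1=N$, where `hN` applies.
      have h1 : Φ.A v - seqExt Φ.theta (r + m) • v ∈ Φ.lower (r + 1) ⊓ Φ.upper (r + 1 + m) :=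
        ⟨sub_mem (Φ.A_mem_lower hv.1) (Submodule.smul_mem _ _ (Φ.lower_monotone (by omega) hv.1)),
          by rw [show r + 1 + m = r + m + 1 by ring]; exact Φ.sub_smul_mem_upper hv.2⟩
      have h2 : Φ.A v - seqExt Φ.theta (r + m) • v ∈ W := by
        rcases Nat.lt_or_eq_of_le (Nat.succ_le_of_lt hr) with h | h
        · exact hle _ h h1
        · rw [hN r h _ h1]
          exact zero_mem _
      have h3 := add_mem h2 (Submodule.smul_mem _ (seqExt Φ.theta (r + m)) (hle r hr hv))
      rwa [sub_add_cancel] at h3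
    exact this
  · have : W ≤ W.comap Φ.As := by
      refine iSup_le fun r => iSup_le fun hr v hv => ?_
      match r, hr, hv with
      | 0, hr, hv =>
        rw [Submodule.mem_comap, Φ.As_apply_of_mem_lower_zero hv.1]
        exact Submodule.smul_mem _ _ (hle 0 hr hv)
      | r + 1, hr, hv =>
        have h1 : Φ.As v - seqExt Φ.thetaStar (r + 1) • v ∈ Φ.lower r ⊓ Φ.upper (r + m) :=
          ⟨Φ.sub_smul_mem_lower hv.1, sub_mem (Φ.As_mem_upper (by omega) hv.2)
            (Submodule.smul_mem _ _ (Φ.upper_antitone (by omega) hv.2))⟩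
        have h3 := add_mem (hle r (by omega) h1)
          (Submodule.smul_mem _ (seqExt Φ.thetaStar (r + 1)) (hle (r + 1) hr hv))
        rwa [sub_add_cancel] at h3
    exact this

/-- The intersections with the same index difference span an invariant subspace contained in
$E_1V+\cdots+E_dV\ne V$, so irreducibility makes it zero. -/
theorem lower_inf_upper_eq_bot {i j : ℕ} (hij : i < j) : Φ.lower i ⊓ Φ.upper j = ⊥ := by
  obtain ⟨m, rfl⟩ := Nat.exists_eq_add_of_lt hij
  -- The bound `i + d + 2` includes index `i` and is so large that the term after the last lies in
  -- `upper` beyond `d`, hence vanishes.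
  have hle : (⨆ r : ℕ, ⨆ _ : r < i + d + 2, Φ.lower r ⊓ Φ.upper (r + (m + 1))) ≤ Φ.upper 1 :=
    iSup_le fun r => iSup_le fun _ => inf_le_right.trans (Φ.upper_antitone (by omega))
  rcases Φ.iSup_inf_eq_bot_or_top (m + 1) (i + d + 2)
    (fun r hr v hv => Φ.eq_zero_of_mem_upper (by omega) hv.2) with h | h
  · rw [eq_bot_iff, ← h]
    exact le_iSup_of_le i (le_iSup_of_le (by omega) le_rfl)
  · exact absurd (top_le_iff.1 (h ▸ hle)) (Φ.upper_ne_top one_pos)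

theorem lower_zero_ne_bot : Φ.lower 0 ≠ ⊥ := by
  intro h
  refine Φ.star.E_ne_zero 0 (LinearMap.ext fun v => ?_)
  have : Φ.Es 0 v ∈ Φ.lower 0 := Φ.mem_lower_zero.2 (LinearMap.congr_fun (Φ.star.E_mul_self 0) v)
  rw [h] at this
  exact this

/-- If the term at $i+1$ vanished, the earlier terms would span an invariant subspace that contains
$E^*_0V\neq0$ and lies in $E^*_0V+\cdots+E^*_iV\ne V$. -/
theorem lower_inf_upper_self_ne_bot {i : ℕ} (hi : i ≤ d) : Φ.lower i ⊓ Φ.upper i ≠ ⊥ := by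
  have h0 : Φ.lower 0 ⊓ Φ.upper 0 = Φ.lower 0 :=
    inf_eq_left.2 fun v _ => mem_upper.2 fun k hk => by omega
  match i, hi with
  | 0, _ => rw [h0]; exact Φ.lower_zero_ne_bot
  | i + 1, hi =>
    intro hbot
    rcases Φ.iSup_inf_eq_bot_or_top 0 (i + 1) (fun r hr v hv => by
      obtain rfl : r = i := by omega
      exact (Submodule.mem_bot K).1 (hbot ▸ hv)) with h | h
    · refine Φ.lower_zero_ne_bot (eq_bot_iff.2 ?_)
      rw [← h, ← h0]
      exact le_iSup_of_le 0 (le_iSup_of_le (by omega) le_rfl)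
    · refine Φ.lower_ne_top (n := i) (by omega) (top_le_iff.1 (h ▸ ?_))
      exact iSup_le fun r => iSup_le fun hr => inf_le_left.trans (Φ.lower_monotone (by omega))

end Split

end TDSystem

namespace TDSystem

variable {K : Type*} {V : Type*} [Field K] [AddCommGroup V] [Module K V] {d : ℕ}

/-! ### The common recurrence and the existence of $q$ -/

section Base

variable (Φ : TDSystem K V d)

/-- The blocks of `A ^ r` relative to the eigenspaces of `As` that are closest to the corner
do not vanish. -/
theorem Es_mul_pow_mul_Es_ne_zero {i j : Fin (d + 1)} {r : ℕ} (hr : 0 < r)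
    (hij : (i : ℕ) + r = j) (hd : (i : ℕ) + j ≤ d) : Φ.Es j * Φ.A ^ r * Φ.Es i ≠ 0 := by
  intro hzero
  obtain ⟨u, hu, hu0⟩ := (Submodule.ne_bot_iff _).1
    (Φ.lower_inf_upper_self_ne_bot (i := i) (by omega))
  have hlow := mem_lower.1 hu.1
  have hup := mem_upper.1 hu.2
  -- The polynomial $p$ has roots $\theta_i,\dots,\theta_{j-1}$, so $p(A)u$ lies in `upper j`. If
  -- the corner block vanishes, it also lies in `lower (j - 1)`, hence is zero.
  set p : K[X] := ∏ m ∈ Finset.range r, (X - C (seqExt Φ.theta (i + m))) with hp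
  have hdeg : p.natDegree = r := by
    rw [hp, natDegree_prod_of_monic _ _ fun _ _ => monic_X_sub_C _]
    simp
  have hsum : ∀ k : Fin (d + 1), Φ.Es k (aeval Φ.A p u) =
      ∑ l, (Φ.Es k * aeval Φ.A p * Φ.Es l) u := fun k => by
    conv_lhs => rw [Φ.star.eq_sum_E_apply u]
    rw [map_sum, map_sum]
    rfl
  have hlow' : aeval Φ.A p u ∈ Φ.lower (j - 1) := by
    refine mem_lower.2 fun k hk => ?_
    rw [hsum]
    refine Finset.sum_eq_zero fun l _ => ?_
    rcases lt_trichotomy (l : ℕ) i with h | h | h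
    · exact LinearMap.congr_fun (Φ.star.E_mul_aeval_As_mul_E p (i := k) (j := l) (by omega)) u
    · obtain rfl := Fin.ext h
      by_cases hkj : k = j
      · subst hkj
        have : Φ.Es k * aeval Φ.A p * Φ.Es l = p.coeff r • (Φ.Es k * Φ.A ^ r * Φ.Es l) :=
          Φ.star.E_mul_aeval_As_mul_E_of_dist p hdeg.le (by omega)
        rw [this, hzero, smul_zero, LinearMap.zero_apply]
      · have := Fin.val_ne_iff.2 hkj
        exact LinearMap.congr_fun (Φ.star.E_mul_aeval_As_mul_E p (i := k) (j := l) (by omega)) u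
    · rw [Module.End.mul_apply, hlow l h, map_zero]
  have hup' : aeval Φ.A p u ∈ Φ.upper j := by
    refine mem_upper.2 fun k hk => ?_
    rw [E_mul_aeval_apply]
    by_cases hki : (k : ℕ) < i
    · rw [hup k hki, smul_zero]
    · rw [hp, eval_prod, Finset.prod_eq_zero (i := (k : ℕ) - i), zero_smul]
      · exact Finset.mem_range.2 (by omega)
      · rw [show (i : ℕ) + (k - i) = k by omega, seqExt_val]
        simp
  have hpu : aeval Φ.A p u = 0 := by
    have : aeval Φ.A p u ∈ Φ.lower (j - 1) ⊓ Φ.upper j := ⟨hlow', hup'⟩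
    rwa [Φ.lower_inf_upper_eq_bot (by omega)] at this
  refine hu0 ?_
  -- From $p(A)u=0$ it follows that $u\in E_iV+\cdots+E_{j-1}V$. In the reversed ordering this is a
  -- forbidden intersection, since $i+j\le d$ means $i<d+1-j$.
  have hmem : u ∈ Φ.ddown.lower i ⊓ Φ.ddown.upper (d + 1 - j) := by
    refine ⟨hu.1, mem_upper.2 fun k hk => ?_⟩
    change Φ.E k.rev u = 0
    have h1 := Φ.E_mul_aeval_apply p k.rev u
    rw [hpu, map_zero] at h1
    refine (smul_eq_zero.1 h1.symm).resolve_left ?_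
    rw [hp, eval_prod]
    refine Finset.prod_ne_zero_iff.2 fun m hm => ?_
    have hm' := Finset.mem_range.1 hm
    rw [eval_sub, eval_X, eval_C, seqExt_of_lt _ (by omega : (i : ℕ) + m < d + 1), sub_ne_zero]
    intro e
    have := congrArg Fin.val (Φ.theta_injective e)
    rw [Fin.val_rev] at this
    simp only at this
    omega
  rwa [Φ.ddown.lower_inf_upper_eq_bot (by omega)] at hmem

theorem E_mul_pow_A_pow_mul_E_eq_zero {i j : Fin (d + 1)} {a b : ℕ} (h : (i : ℕ) + a + b < j) :
    Φ.E j * (Φ.As ^ a * (Φ.A * Φ.As ^ b)) * Φ.E i = 0 := by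
  rw [E_mul_mul_mul_E]
  refine Finset.sum_eq_zero fun k _ => ?_
  rw [← mul_assoc (Φ.E k), E_mul_A, smul_mul_assoc, smul_mul_assoc]
  by_cases hk : (i : ℕ) + b < k
  · rw [Φ.E_mul_pow_mul_E b (Or.inl hk), smul_zero, mul_zero]
  · rw [Φ.E_mul_pow_mul_E a (Or.inl (by omega)), zero_mul]

theorem E_mul_pow_A_pow_mul_E {i j : Fin (d + 1)} {a b : ℕ} (h : (i : ℕ) + (a + b) = j) :
    Φ.E j * (Φ.As ^ a * (Φ.A * Φ.As ^ b)) * Φ.E i =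
      seqExt Φ.theta (i + b) • (Φ.E j * Φ.As ^ (a + b) * Φ.E i) := by
  have hl : (i : ℕ) + b < d + 1 := by omega
  have hne : ∀ k : Fin (d + 1), k ≠ ⟨i + b, hl⟩ → (i : ℕ) + b < k ∨ (k : ℕ) + a < j := by
    intro k hk
    have : (k : ℕ) ≠ i + b := fun e => hk (Fin.ext e)
    omega
  rw [E_mul_mul_mul_E, pow_add, E_mul_mul_mul_E, Finset.sum_eq_single ⟨i + b, hl⟩,
    Finset.sum_eq_single ⟨i + b, hl⟩, ← mul_assoc (Φ.E _) Φ.A, E_mul_A, smul_mul_assoc,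
    smul_mul_assoc, mul_smul_comm, seqExt_of_lt _ hl]
  · intro k _ hk
    rcases hne k hk with h' | h'
    · rw [Φ.E_mul_pow_mul_E b (Or.inl h'), mul_zero]
    · rw [Φ.E_mul_pow_mul_E a (Or.inl h'), zero_mul]
  · simp
  · intro k _ hk
    rw [← mul_assoc (Φ.E k), E_mul_A, smul_mul_assoc, smul_mul_assoc]
    rcases hne k hk with h' | h'
    · rw [Φ.E_mul_pow_mul_E b (Or.inl h'), smul_zero, mul_zero]
    · rw [Φ.E_mul_pow_mul_E a (Or.inl h'), zero_mul]
  · simp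

/-- A commutator relation between `A` and `As`. -/
def IsCommutatorPoly (f : K[X]) : Prop :=
  Φ.A ^ 2 * (Φ.As * Φ.A ^ 1) - Φ.A ^ 1 * (Φ.As * Φ.A ^ 2) =
    aeval Φ.A f * Φ.As - Φ.As * aeval Φ.A f

theorem E_mul_pow_As_pow_mul_E (a b : ℕ) (i j : Fin (d + 1)) :
    Φ.E i * (Φ.A ^ a * (Φ.As * Φ.A ^ b)) * Φ.E j =
      (Φ.theta i ^ a * Φ.theta j ^ b) • (Φ.E i * Φ.As * Φ.E j) := by
  have h1 : Φ.E i * Φ.A ^ a = Φ.theta i ^ a • Φ.E i := by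
    simpa using Φ.E_mul_aeval (X ^ a) i
  have h2 : Φ.A ^ b * Φ.E j = Φ.theta j ^ b • Φ.E j := by
    simpa using Φ.aeval_mul_E (X ^ b) j
  rw [← mul_assoc, h1, mul_assoc, mul_assoc, h2, smul_mul_assoc, mul_smul_comm, mul_smul_comm,
    smul_smul, mul_assoc]

/-- On the $(i,j)$ block the relation reads
$\theta_i\theta_j(\theta_i-\theta_j)=f(\theta_i)-f(\theta_j)$ times $E_iA^*E_j$, which vanishes for
$|i-j|>1$. Only adjacent differences of $f$ are prescribed, so telescoping sums give values to
interpolate. -/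
theorem exists_isCommutatorPoly : ∃ f : K[X], f.natDegree ≤ d ∧ Φ.IsCommutatorPoly f ∧
    ∀ n, n + 1 ≤ d → f.eval (seqExt Φ.theta n) - f.eval (seqExt Φ.theta (n + 1)) =
      seqExt Φ.theta n * seqExt Φ.theta (n + 1) *
        (seqExt Φ.theta n - seqExt Φ.theta (n + 1)) := by
  set θ := seqExt Φ.theta with hθ
  set v : ℕ → K := fun n => ∑ k ∈ Finset.range n, θ k * θ (k + 1) * (θ (k + 1) - θ k) with hv
  set f : K[X] := Lagrange.interpolate Finset.univ Φ.theta fun i => v i with hf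
  have heval : ∀ i : Fin (d + 1), f.eval (Φ.theta i) = v i := fun i =>
    Lagrange.eval_interpolate_at_node _ Φ.theta_injective.injOn (Finset.mem_univ i)
  have hstep : ∀ n, n + 1 ≤ d →
      f.eval (θ n) - f.eval (θ (n + 1)) = θ n * θ (n + 1) * (θ n - θ (n + 1)) := by
    intro n hn
    rw [hθ, seqExt_of_lt _ (by omega : n < d + 1), seqExt_of_lt _ (by omega : n + 1 < d + 1),
      heval, heval, ← seqExt_of_lt Φ.theta (by omega : n < d + 1),
      ← seqExt_of_lt Φ.theta (by omega : n + 1 < d + 1), ← hθ]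
    simp only [hv, Finset.sum_range_succ]
    ring
  refine ⟨f, ?_, ?_, hstep⟩
  · have h := Lagrange.degree_interpolate_lt (s := Finset.univ) (v := Φ.theta)
      (fun i : Fin (d + 1) => v i) Φ.theta_injective.injOn
    rw [Finset.card_univ, Fintype.card_fin] at h
    exact natDegree_le_of_degree_le (Order.lt_succ_iff.1 (by exact_mod_cast h))
  · refine Φ.ext_E fun i j => ?_
    rw [mul_sub, sub_mul, E_mul_pow_As_pow_mul_E, E_mul_pow_As_pow_mul_E, mul_sub, sub_mul,
      ← mul_assoc (Φ.E i), E_mul_aeval, mul_assoc (Φ.E i) (Φ.As * _), mul_assoc Φ.As, aeval_mul_E, smul_mul_assoc,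
      smul_mul_assoc, mul_smul_comm, mul_smul_comm, ← sub_smul, ← mul_assoc, ← sub_smul]
    have hval : ∀ k : Fin (d + 1), Φ.theta k = θ k := fun k => (seqExt_val _ k).symm
    rcases lt_trichotomy (i : ℕ) j with h | h | h
    · by_cases h1 : (i : ℕ) + 1 = j
      · congr 1
        rw [hval i, hval j, ← h1, hstep _ (by omega)]
        ring
      · rw [Φ.E_mul_As_mul_E (Or.inr (by omega)), smul_zero, smul_zero]
    · congr 1
      rw [Fin.ext h]
      ring
    · by_cases h1 : (j : ℕ) + 1 = i
      · congr 1
        rw [hval i, hval j, ← h1]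
        linear_combination hstep j (by omega)
      · rw [Φ.E_mul_As_mul_E (Or.inl (by omega)), smul_zero, smul_zero]

theorem Es_mul_commutator_mul_Es (X : Module.End K V) (i j : Fin (d + 1)) :
    Φ.Es j * (X * Φ.As - Φ.As * X) * Φ.Es i =
      (Φ.thetaStar i - Φ.thetaStar j) • (Φ.Es j * X * Φ.Es i) := by
  have h1 : Φ.As * Φ.Es i = Φ.thetaStar i • Φ.Es i := Φ.star.A_mul_E i
  have h2 : Φ.Es j * Φ.As = Φ.thetaStar j • Φ.Es j := Φ.star.E_mul_A j
  rw [mul_sub, sub_mul, ← mul_assoc, ← mul_assoc, h2, mul_assoc _ Φ.As, h1, mul_smul_comm,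
    smul_mul_assoc, smul_mul_assoc, sub_smul]

variable {Φ}

/-- With $j=\deg f>3$, the left side of the relation is too short in $A$ to reach from $E^*_0V$ to
$E^*_jV$, while the right side has there a nonzero multiple of the nonvanishing corner block of
$A^j$. -/
theorem IsCommutatorPoly.natDegree_le {f : K[X]} (hf : Φ.IsCommutatorPoly f)
    (hd : f.natDegree ≤ d) : f.natDegree ≤ 3 := by
  by_contra! h3
  set j : Fin (d + 1) := ⟨f.natDegree, by omega⟩ with hj
  have h := congrArg (fun Y => Φ.Es j * Y * Φ.Es 0) hf
  have hz : ∀ a b, a + b = 3 → Φ.Es j * (Φ.A ^ a * (Φ.As * Φ.A ^ b)) * Φ.Es 0 = 0 := fun a b hab =>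
    Φ.star.E_mul_pow_A_pow_mul_E_eq_zero (by simp [hj]; omega)
  have hlead : Φ.Es j * aeval Φ.A f * Φ.Es 0 =
      f.coeff f.natDegree • (Φ.Es j * Φ.A ^ f.natDegree * Φ.Es 0) :=
    Φ.star.E_mul_aeval_As_mul_E_of_dist f le_rfl (by simp [hj])
  simp only [Es_mul_commutator_mul_Es] at h
  rw [mul_sub, sub_mul, hz 2 1 rfl, hz 1 2 rfl, sub_zero, hlead] at h
  have hne := Φ.Es_mul_pow_mul_Es_ne_zero (i := 0) (j := j) (r := f.natDegree) (by omega)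
    (by simp [hj]) (by simp [hj, hd])
  have hf0 : f.coeff f.natDegree ≠ 0 := leadingCoeff_ne_zero.2 fun h0 => by simp [h0] at h3
  have hth : Φ.thetaStar 0 - Φ.thetaStar j ≠ 0 := sub_ne_zero.2 fun e => by
    have := congrArg Fin.val (Φ.thetaStar_injective e)
    simp [hj] at this
    omega
  exact smul_ne_zero hth (smul_ne_zero hf0 hne) h.symm

/-- Blocks from $E^*_kV$ to $E^*_{k+3}V$ are compared: each factor $A$ must move up by one, so $A^*$
acts as $\theta^*_{k+1}$ or $\theta^*_{k+2}$, and everything is a multiple of one nonzero block of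
$A^3$. -/
theorem IsCommutatorPoly.thetaStar_recurrence_of_le {f : K[X]} (hf : Φ.IsCommutatorPoly f)
    (h3 : f.natDegree ≤ 3) {k : ℕ} (hk : k + (k + 3) ≤ d) :
    seqExt Φ.thetaStar (k + 1) - seqExt Φ.thetaStar (k + 2) =
      f.coeff 3 * (seqExt Φ.thetaStar k - seqExt Φ.thetaStar (k + 3)) := by
  set i : Fin (d + 1) := ⟨k, by omega⟩ with hi
  set j : Fin (d + 1) := ⟨k + 3, by omega⟩ with hj
  have h := congrArg (fun Y => Φ.Es j * Y * Φ.Es i) hf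
  have h1 : Φ.Es j * (Φ.A ^ 2 * (Φ.As * Φ.A ^ 1)) * Φ.Es i =
      seqExt Φ.thetaStar (k + 1) • (Φ.Es j * Φ.A ^ 3 * Φ.Es i) :=
    Φ.star.E_mul_pow_A_pow_mul_E rfl
  have h2 : Φ.Es j * (Φ.A ^ 1 * (Φ.As * Φ.A ^ 2)) * Φ.Es i =
      seqExt Φ.thetaStar (k + 2) • (Φ.Es j * Φ.A ^ 3 * Φ.Es i) :=
    Φ.star.E_mul_pow_A_pow_mul_E rfl
  have hlead : Φ.Es j * aeval Φ.A f * Φ.Es i = f.coeff 3 • (Φ.Es j * Φ.A ^ 3 * Φ.Es i) :=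
    Φ.star.E_mul_aeval_As_mul_E_of_dist f h3 (Or.inl rfl)
  have hne := Φ.Es_mul_pow_mul_Es_ne_zero (i := i) (j := j) (r := 3) (by omega) rfl hk
  simp only [Es_mul_commutator_mul_Es] at h
  rw [mul_sub, sub_mul, h1, h2, hlead, ← sub_smul, smul_smul] at h
  rw [seqExt_of_lt _ (by omega : k < d + 1), seqExt_of_lt _ (by omega : k + 3 < d + 1),
    smul_left_injective K hne h, mul_comm]

theorem IsCommutatorPoly.thetaStar_recurrence {f : K[X]} (hf : Φ.IsCommutatorPoly f)
    (h3 : f.natDegree ≤ 3) {k : ℕ} (hk : k + 3 ≤ d) :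
    seqExt Φ.thetaStar (k + 1) - seqExt Φ.thetaStar (k + 2) =
      f.coeff 3 * (seqExt Φ.thetaStar k - seqExt Φ.thetaStar (k + 3)) := by
  by_cases h : k + (k + 3) ≤ d
  · exact hf.thetaStar_recurrence_of_le h3 h
  -- The relation does not involve the ordering of the $E^*_i$, so the remaining indices follow from
  -- $\Phi^{\downarrow}$, with $k$ replaced by $d-3-k$.
  · have hf' : Φ.down.IsCommutatorPoly f := hf
    obtain ⟨m, rfl⟩ : ∃ m, d = k + 3 + m := ⟨d - (k + 3), by omega⟩
    have := hf'.thetaStar_recurrence_of_le h3 (k := m) (by omega)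
    rw [show Φ.down.thetaStar = fun i => Φ.thetaStar i.rev from rfl, seqExt_rev _ (by omega),
      seqExt_rev _ (by omega), seqExt_rev _ (by omega), seqExt_rev _ (by omega),
      show k + 3 + m - (m + 1) = k + 2 by omega, show k + 3 + m - (m + 2) = k + 1 by omega,
      show k + 3 + m - (m + 3) = k by omega, show k + 3 + m - m = k + 3 by omega] at this
    linear_combination -this

end Base

/-- Divided differences of a cubic: the first ones are $t_0t_1,t_1t_2,t_2t_3$, hence the second ones
are $t_1,t_2$, and the third is the leading coefficient $a_3$. -/
theorem _root_.cubic_recurrence {a₀ a₁ a₂ a₃ t₀ t₁ t₂ t₃ : K} (h01 : t₀ ≠ t₁) (h12 : t₁ ≠ t₂)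
    (h23 : t₂ ≠ t₃) (h02 : t₀ ≠ t₂) (h13 : t₁ ≠ t₃) {f : K → K}
    (hf : ∀ x, f x = a₀ + a₁ * x + a₂ * x ^ 2 + a₃ * x ^ 3)
    (e0 : f t₀ - f t₁ = t₀ * t₁ * (t₀ - t₁)) (e1 : f t₁ - f t₂ = t₁ * t₂ * (t₁ - t₂))
    (e2 : f t₂ - f t₃ = t₂ * t₃ * (t₂ - t₃)) : t₁ - t₂ = a₃ * (t₀ - t₃) := by
  have key : ∀ {s t : K}, s ≠ t → f s - f t = s * t * (s - t) →
      a₁ + a₂ * (s + t) + a₃ * (s ^ 2 + s * t + t ^ 2) = s * t := fun {s t} h e => by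
    refine mul_right_cancel₀ (sub_ne_zero.2 h) ?_
    rw [← e, hf, hf]
    ring
  have k0 := key h01 e0
  have k1 := key h12 e1
  have k2 := key h23 e2
  have m0 : a₂ + a₃ * (t₀ + t₁ + t₂) = t₁ :=
    mul_right_cancel₀ (sub_ne_zero.2 h02) (by linear_combination k0 - k1)
  have m1 : a₂ + a₃ * (t₁ + t₂ + t₃) = t₂ :=
    mul_right_cancel₀ (sub_ne_zero.2 h13) (by linear_combination k1 - k2)
  linear_combination m1 - m0

variable (Φ : TDSystem K V d)

theorem seqExt_theta_ne {m n : ℕ} (hm : m ≤ d) (hn : n ≤ d) (h : m ≠ n) :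
    seqExt Φ.theta m ≠ seqExt Φ.theta n := by
  rw [seqExt_of_lt _ (by omega : m < d + 1), seqExt_of_lt _ (by omega : n < d + 1)]
  exact fun e => h (congrArg Fin.val (Φ.theta_injective e))

theorem exists_common_recurrence : ∃ c : K, ∀ k, k + 3 ≤ d →
    seqExt Φ.theta (k + 1) - seqExt Φ.theta (k + 2) =
      c * (seqExt Φ.theta k - seqExt Φ.theta (k + 3)) ∧
    seqExt Φ.thetaStar (k + 1) - seqExt Φ.thetaStar (k + 2) =
      c * (seqExt Φ.thetaStar k - seqExt Φ.thetaStar (k + 3)) := by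
  obtain ⟨f, hfd, hf, hstep⟩ := Φ.exists_isCommutatorPoly
  have h3 := hf.natDegree_le hfd
  refine ⟨f.coeff 3, fun k hk => ⟨?_, hf.thetaStar_recurrence h3 hk⟩⟩
  refine cubic_recurrence (a₀ := f.coeff 0) (a₁ := f.coeff 1) (a₂ := f.coeff 2)
    (f := fun x => f.eval x)
    (Φ.seqExt_theta_ne (by omega) (by omega) (by omega))
    (Φ.seqExt_theta_ne (by omega) (by omega) (by omega))
    (Φ.seqExt_theta_ne (by omega) (by omega) (by omega))
    (Φ.seqExt_theta_ne (by omega) (by omega) (by omega))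
    (Φ.seqExt_theta_ne (by omega) (by omega) (by omega)) (fun x => ?_)
    (hstep k (by omega)) (hstep (k + 1) (by omega)) (hstep (k + 2) (by omega))
  simp [eval_eq_sum_range' (Nat.lt_succ_of_le h3), Finset.sum_range_succ]

theorem exists_isBase : ∃ q, Φ.IsBase q := by
  obtain ⟨c, hc⟩ := Φ.exists_common_recurrence
  -- The scalar $q$ is to satisfy $q+q^{-1}=\beta$. For $d\ge3$ the recurrence forces $c\ne0$; for
  -- $d\le2$ there is no condition, and the value of `c⁻¹` is irrelevant.
  set β := algebraMap K (AlgebraicClosure K) (c⁻¹ - 1) with hβ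
  obtain ⟨q, hq⟩ := IsAlgClosed.exists_root (X ^ 2 - C β * X + 1 : (AlgebraicClosure K)[X]) (by
    have : (X ^ 2 - C β * X + 1 : (AlgebraicClosure K)[X]).degree = 2 := by compute_degree!
    rw [this]
    decide)
  simp only [IsRoot.def, eval_add, eval_sub, eval_pow, eval_X, eval_mul, eval_C, eval_one] at hq
  have hq0 : q ≠ 0 := by
    rintro rfl
    simp at hq
  have hqβ : q + q⁻¹ + 1 = algebraMap K (AlgebraicClosure K) c⁻¹ := by
    have : algebraMap K (AlgebraicClosure K) c⁻¹ = β + 1 := by simp [hβ]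
    rw [this]
    field_simp
    linear_combination hq
  have hdiv : ∀ {x y : K}, x ≠ 0 → x = c * y → y / x = c⁻¹ := fun {x y} hx h => by
    have hc0 : c ≠ 0 := by rintro rfl; simp [h] at hx
    rw [h] at hx ⊢
    have hy := right_ne_zero_of_mul hx
    field_simp
  refine ⟨q, hq0, fun k hk => ?_⟩
  obtain ⟨h1, h2⟩ := hc k (by omega)
  rw [hqβ]
  simp only [← seqExt_of_lt]
  exact ⟨congrArg _ (hdiv (sub_ne_zero.2 (Φ.seqExt_theta_ne (by omega) (by omega) (by omega))) h1),
    congrArg _ (hdiv (sub_ne_zero.2 (Φ.star.seqExt_theta_ne (by omega) (by omega) (by omega))) h2)⟩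

end TDSystem

namespace TDSystem

variable {K : Type*} {V : Type*} [Field K] [AddCommGroup V] [Module K V] {d : ℕ}

/-! ### Sharp systems and their split sequences -/

section Sharp

variable {Φ : TDSystem K V d}

theorem range_Es_zero (Φ : TDSystem K V d) : LinearMap.range (Φ.Es 0) = Φ.lower 0 := by
  ext v
  rw [mem_lower_zero]
  refine ⟨?_, fun h => ⟨v, h⟩⟩
  rintro ⟨w, rfl⟩
  exact LinearMap.congr_fun (Φ.star.E_mul_self 0) w

theorem eq_zero_of_E_zero_apply (Φ : TDSystem K V d) {v : V} (hv : v ∈ Φ.lower 0)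
    (h : Φ.E 0 v = 0) : v = 0 := by
  have : v ∈ Φ.lower 0 ⊓ Φ.upper 1 :=
    ⟨hv, mem_upper.2 fun k hk => by
      obtain rfl : k = 0 := Fin.ext (Nat.lt_one_iff.1 hk)
      exact h⟩
  rwa [Φ.lower_inf_upper_eq_bot one_pos] at this

theorem E_zero_mul_Es_zero_ne_zero (Φ : TDSystem K V d) : Φ.E 0 * Φ.Es 0 ≠ 0 := by
  intro h
  refine Φ.star.E_ne_zero 0 (LinearMap.ext fun v => ?_)
  exact Φ.eq_zero_of_E_zero_apply (by rw [← range_Es_zero]; exact ⟨v, rfl⟩)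
    (LinearMap.congr_fun h v)

/-- $E_0$ is injective on $E^*_0V$, because $E^*_0V$ meets $E_1V+\cdots+E_dV$ trivially; thus
$0<\dim E^*_0V\le\dim E_0V=1$. -/
theorem IsSharp.star [FiniteDimensional K V] (h : Φ.IsSharp) : Φ.star.IsSharp := by
  have hinj : Function.Injective
      ((Φ.E 0).rangeRestrict ∘ₗ (LinearMap.range (Φ.Es 0)).subtype) := by
    rw [← LinearMap.ker_eq_bot, eq_bot_iff]
    rintro ⟨v, hv⟩ hv0
    have h0 : Φ.E 0 v = 0 := congrArg Subtype.val hv0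
    rw [range_Es_zero] at hv
    exact (Submodule.mem_bot K).2 (Subtype.ext (Φ.eq_zero_of_E_zero_apply hv h0))
  have hle := LinearMap.finrank_le_finrank_of_injective hinj
  have hpos : Module.finrank K (LinearMap.range (Φ.Es 0)) ≠ 0 := fun h0 =>
    Φ.star.E_ne_zero 0 (LinearMap.range_eq_bot.1 (Submodule.finrank_eq_zero.1 h0))
  change Module.finrank K (LinearMap.range (Φ.Es 0)) = 1
  have h1 : Module.finrank K (LinearMap.range (Φ.E 0)) = 1 := h
  omega

theorem IsSharp.down (h : Φ.IsSharp) : Φ.down.IsSharp := h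

theorem IsSharp.ddown [FiniteDimensional K V] (h : Φ.IsSharp) : Φ.ddown.IsSharp := by
  have : Φ.ddown.star.IsSharp := h.star
  exact this.star

theorem IsSharp.relative [FiniteDimensional K V] (h : Φ.IsSharp) (a b c : Bool) :
    (Φ.relative a b c).IsSharp := by
  cases a <;> cases b <;> cases c
  exacts [h, h.star, h.ddown, h.ddown.star, h.down, h.down.star, h.down.ddown, h.down.ddown.star]

theorem splitSpace_zero (Φ : TDSystem K V d) : Φ.splitSpace 0 = LinearMap.range (Φ.Es 0) := by
  have h1 : (⨆ j : Fin (d + 1), ⨆ _ : j ≤ 0, LinearMap.range (Φ.Es j)) =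
      LinearMap.range (Φ.Es 0) :=
    le_antisymm (iSup_le fun j => iSup_le fun hj => by rw [Fin.le_zero_iff.1 hj])
      (le_iSup_of_le 0 (le_iSup_of_le le_rfl le_rfl))
  have h2 : (⨆ j : Fin (d + 1), ⨆ _ : 0 ≤ j, LinearMap.range (Φ.E j)) = ⊤ := by
    rw [eq_top_iff, ← Φ.iSup_eigenspace]
    exact iSup_le fun j => le_iSup_of_le j (le_iSup_of_le (Fin.zero_le j) (Φ.range_E j).ge)
  rw [splitSpace, h1, h2, inf_top_eq]

theorem IsSharp.exists_E_zero_mul_mul (h : Φ.IsSharp) (X : Module.End K V) :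
    ∃ c : K, Φ.E 0 * X * Φ.E 0 = c • Φ.E 0 := by
  obtain ⟨⟨u, hu⟩, hu0, hspan⟩ := finrank_eq_one_iff'.1 h
  obtain ⟨w, rfl⟩ := hu
  obtain ⟨c, hc⟩ := hspan ⟨Φ.E 0 (X (Φ.E 0 w)), ⟨_, rfl⟩⟩
  have hc' : c • Φ.E 0 w = Φ.E 0 (X (Φ.E 0 w)) := congrArg Subtype.val hc
  refine ⟨c, LinearMap.ext fun v => ?_⟩
  obtain ⟨a, ha⟩ := hspan ⟨Φ.E 0 v, ⟨v, rfl⟩⟩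
  have ha' : a • Φ.E 0 w = Φ.E 0 v := congrArg Subtype.val ha
  simp only [Module.End.mul_apply, LinearMap.smul_apply]
  rw [← ha', map_smul, map_smul, ← hc', smul_comm]

theorem splitOperator_eq (Φ : TDSystem K V d) (i : Fin (d + 1)) : Φ.splitOperator i =
    aeval Φ.As (shiftedTauPoly Φ.thetaStar i) * aeval Φ.A (tauPoly Φ.theta i) := rfl

theorem Es_mul_aeval_As (Φ : TDSystem K V d) (f : K[X]) (k : Fin (d + 1)) :
    Φ.Es k * aeval Φ.As f = f.eval (Φ.thetaStar k) • Φ.Es k := Φ.star.E_mul_aeval f k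

/-- $\tau_i(A)$ sends $E^*_0V$ into $E^*_0V+\cdots+E^*_iV$, and the factors $A^*-\theta^*_k$ with
$1\le k\le i$ kill all components but the one in $E^*_0V$. So the split operator preserves $E^*_0V$.
-/
theorem Es_mul_splitOperator_mul_Es (Φ : TDSystem K V d) (i k : Fin (d + 1)) (hk : k ≠ 0) :
    Φ.Es k * Φ.splitOperator i * Φ.Es 0 = 0 := by
  have hk0 : 0 < (k : ℕ) := Nat.pos_of_ne_zero fun h => hk (Fin.ext h)
  rw [splitOperator_eq, ← mul_assoc, Es_mul_aeval_As, smul_mul_assoc, smul_mul_assoc]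
  by_cases hki : (k : ℕ) ≤ i
  · rw [shiftedTauPoly_eval_eq_zero _ hk0 hki, zero_smul]
  · have : Φ.Es k * aeval Φ.A (tauPoly Φ.theta i) * Φ.Es 0 = 0 :=
      Φ.star.E_mul_aeval_As_mul_E _ (by rw [tauPoly_natDegree _ (by omega)]; simp; omega)
    rw [this, smul_zero]

theorem splitOperator_mul_Es_zero (Φ : TDSystem K V d) (i : Fin (d + 1)) :
    Φ.splitOperator i * Φ.Es 0 = Φ.Es 0 * Φ.splitOperator i * Φ.Es 0 := by
  have h : ∑ k, Φ.Es k = 1 := Φ.star.sum_E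
  rw [← one_mul (Φ.splitOperator i * Φ.Es 0), ← h, Finset.sum_mul, Finset.sum_eq_single 0,
    mul_assoc]
  · intro k _ hk
    rw [← mul_assoc, Φ.Es_mul_splitOperator_mul_Es i k hk]
  · simp

theorem E_zero_eq_sum (Φ : TDSystem K V d) : Φ.E 0 =
    ∑ j : Fin (d + 1), (headProd Φ.theta j)⁻¹ • aeval Φ.A (tauPoly Φ.theta j) := by
  have hpoly := congrArg (aeval Φ.A) (sum_tauPoly_div_headProd Φ.theta_injective (le_refl d))
  rw [map_sum, ← Fin.sum_univ_eq_sum_range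
    (fun j => aeval Φ.A (C (headProd Φ.theta j)⁻¹ * tauPoly Φ.theta j))] at hpoly
  simp only [map_mul, aeval_C, ← Algebra.smul_def] at hpoly
  rw [hpoly]
  rw [← Φ.sum_mul_E ((headProd Φ.theta d)⁻¹ • _), Finset.sum_eq_single 0]
  · rw [smul_mul_assoc, aeval_mul_E]
    rw [shiftedTauPoly_eval_zero, smul_smul, inv_mul_cancel₀ (headProd_ne_zero Φ.theta_injective d),
      one_smul]
  · intro k _ hk
    have hk0 : 0 < (k : ℕ) := Nat.pos_of_ne_zero fun h => hk (Fin.ext h)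
    rw [smul_mul_assoc, aeval_mul_E, shiftedTauPoly_eval_eq_zero _ hk0 (by omega), zero_smul,
      smul_zero]
  · simp

/-- `τ j (A) V` is contained in `E j V + ⋯ + E d V`. -/
theorem E_zero_mul_aeval_As_mul_tauPoly (Φ : TDSystem K V d) (f : K[X]) {j : ℕ}
    (hf : f.natDegree < j) :
    Φ.E 0 * aeval Φ.As f * aeval Φ.A (tauPoly Φ.theta j) = 0 := by
  rw [← Φ.sum_mul_E (_ * aeval Φ.A _)]
  refine Finset.sum_eq_zero fun k _ => ?_
  rw [mul_assoc, aeval_mul_E, mul_smul_comm]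
  by_cases hk : (k : ℕ) < j
  · rw [tauPoly_eval_eq_zero _ hk, zero_smul]
  · rw [Φ.E_mul_aeval_As_mul_E f (Or.inr (by simp; omega)), smul_zero]

theorem tauPolyStar_mul_tauPoly_mul_Es (Φ : TDSystem K V d) {i j : ℕ} (hij : j < i) (hi : i ≤ d) :
    aeval Φ.As (tauPoly Φ.thetaStar i) * aeval Φ.A (tauPoly Φ.theta j) * Φ.Es 0 = 0 := by
  have h : ∑ k, Φ.Es k = 1 := Φ.star.sum_E
  rw [← one_mul (_ * Φ.Es 0), ← h, Finset.sum_mul]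
  refine Finset.sum_eq_zero fun k _ => ?_
  rw [← mul_assoc, ← mul_assoc, Es_mul_aeval_As, smul_mul_assoc, smul_mul_assoc]
  by_cases hk : (k : ℕ) < i
  · rw [tauPoly_eval_eq_zero _ hk, zero_smul]
  · have : Φ.Es k * aeval Φ.A (tauPoly Φ.theta j) * Φ.Es 0 = 0 :=
      Φ.star.E_mul_aeval_As_mul_E _ (by rw [tauPoly_natDegree _ (by omega)]; simp; omega)
    rw [this, smul_zero]

variable [FiniteDimensional K V]

theorem IsSharp.isSplitEigenvalue_splitSeq (h : Φ.IsSharp) (i : Fin (d + 1)) :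
    Φ.IsSplitEigenvalue i (Φ.splitSeq i) := by
  have hex : ∃ z, Φ.IsSplitEigenvalue i z := by
    obtain ⟨c, hc⟩ : ∃ c : K, Φ.Es 0 * Φ.splitOperator i * Φ.Es 0 = c • Φ.Es 0 :=
      h.star.exists_E_zero_mul_mul (Φ.splitOperator i)
    refine ⟨c, fun u hu => ?_⟩
    rw [splitSpace_zero] at hu
    obtain ⟨w, rfl⟩ := hu
    rw [← splitOperator_mul_Es_zero] at hc
    exact LinearMap.congr_fun hc w
  rw [splitSeq, dif_pos hex]
  exact hex.choose_spec

theorem IsSharp.splitOperator_mul_Es (h : Φ.IsSharp) (i : Fin (d + 1)) :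
    Φ.splitOperator i * Φ.Es 0 = Φ.splitSeq i • Φ.Es 0 :=
  LinearMap.ext fun v =>
    h.isSplitEigenvalue_splitSeq i (Φ.Es 0 v) (by rw [splitSpace_zero]; exact ⟨v, rfl⟩)

/-- The split sequence through the compressions of the polynomials `τ i` in `A`. -/
theorem IsSharp.Es_mul_tauPoly_mul_Es (h : Φ.IsSharp) (i : Fin (d + 1)) :
    Φ.Es 0 * aeval Φ.A (tauPoly Φ.theta i) * Φ.Es 0 =
      (Φ.splitSeq i / headProd Φ.thetaStar i) • Φ.Es 0 := by
  have h1 := Φ.splitOperator_mul_Es_zero i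
  rw [h.splitOperator_mul_Es, splitOperator_eq, ← mul_assoc, Es_mul_aeval_As,
    shiftedTauPoly_eval_zero, smul_mul_assoc, smul_mul_assoc] at h1
  have h2 := headProd_ne_zero Φ.thetaStar_injective i
  rw [div_eq_inv_mul, mul_smul, h1, smul_smul, inv_mul_cancel₀ h2, one_smul]

/-- A form suited to comparing $\Phi$ with $\Phi^*$. Replacing the shifted product in $A^*$ by
$\tau^*_i(A^*)$ changes it by a polynomial of degree below $i$, which disappears between $E_0$ and
$\tau_i(A)$. -/
theorem IsSharp.E_mul_tauPolyStar_mul_tauPoly_mul_Es (h : Φ.IsSharp) (i : Fin (d + 1)) :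
    Φ.E 0 * aeval Φ.As (tauPoly Φ.thetaStar i) * aeval Φ.A (tauPoly Φ.theta i) * Φ.Es 0 =
      Φ.splitSeq i • (Φ.E 0 * Φ.Es 0) := by
  have h1 : Φ.E 0 * (Φ.splitOperator i * Φ.Es 0) = Φ.splitSeq i • (Φ.E 0 * Φ.Es 0) := by
    rw [h.splitOperator_mul_Es, mul_smul_comm]
  rw [← h1, splitOperator_eq]
  simp only [← mul_assoc]
  rcases Nat.eq_zero_or_pos (i : ℕ) with h0 | h0
  · rw [h0, tauPoly_zero, shiftedTauPoly_zero]
  · have h2 := Φ.E_zero_mul_aeval_As_mul_tauPoly _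
      (natDegree_tauPoly_sub_shiftedTauPoly Φ.thetaStar (by omega : (i : ℕ) ≤ d) h0)
    rw [map_sub, mul_sub, sub_mul, sub_eq_zero] at h2
    rw [h2]

/-- `Φ` and `Φ^*` have the same split sequence. -/
theorem IsSharp.splitSeq_star (h : Φ.IsSharp) : Φ.star.splitSeq = Φ.splitSeq := by
  funext i
  have h1 : Φ.E 0 * aeval Φ.As (tauPoly Φ.thetaStar i) * Φ.E 0 =
      (Φ.star.splitSeq i / headProd Φ.theta i) • Φ.E 0 := h.star.Es_mul_tauPoly_mul_Es i
  -- In $E_0\tau^*_i(A^*)E_0E^*_0$ the inner $E_0$ is expanded in the $\tau_j(A)$. Terms with $j<i$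
  -- are killed on the right by $\tau^*_i(A^*)\tau_j(A)E^*_0=0$, terms with $j>i$ on the left by
  -- $E_0\tau^*_i(A^*)\tau_j(A)=0$.
  have h2 := congrArg (fun Y => Y * Φ.Es 0) h1
  conv_lhs at h2 =>
    rw [mul_assoc _ (Φ.E 0) (Φ.Es 0)]
    enter [2, 1]
    rw [E_zero_eq_sum]
  rw [Finset.sum_mul, Finset.mul_sum, Finset.sum_eq_single i, smul_mul_assoc, mul_smul_comm,
    ← mul_assoc, h.E_mul_tauPolyStar_mul_tauPoly_mul_Es, smul_mul_assoc, smul_smul] at h2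
  · have h3 := smul_left_injective K Φ.E_zero_mul_Es_zero_ne_zero h2
    have h4 := headProd_ne_zero Φ.theta_injective i
    field_simp at h3
    exact h3.symm
  · intro j _ hj
    rw [smul_mul_assoc, mul_smul_comm, ← mul_assoc]
    rcases Nat.lt_or_gt_of_ne (Fin.val_ne_iff.2 hj) with hlt | hgt
    · have := Φ.tauPolyStar_mul_tauPoly_mul_Es hlt (by omega)
      rw [mul_assoc, mul_assoc, ← mul_assoc (aeval Φ.As _), this, mul_zero, smul_zero]
    · rw [Φ.E_zero_mul_aeval_As_mul_tauPoly _ (by rw [tauPoly_natDegree _ (by omega)]; exact hgt),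
        zero_mul, smul_zero]
  · simp

end Sharp

end TDSystem

namespace TDSystem

variable {K : Type*} {V : Type*} [Field K] [AddCommGroup V] [Module K V] {d : ℕ}

/-! ### Transition formulas between relatives -/

section Transition

variable {Φ : TDSystem K V d}

/-- The Newton expansion of $\eta_i$, evaluated at $A$ and compressed to $E^*_0V$. The polynomial
$\eta_i$ is the $\tau_i$ of $\Phi^{\Downarrow}$, so both sides become split sequence terms. -/
theorem IsSharp.ddown_splitSeq_div [FiniteDimensional K V] (hΦ : Φ.IsSharp)
    {B : ℕ → ℕ → ℕ → K} (hB : IsPascalBracket d (seqExt Φ.theta) B) (i : Fin (d + 1)) :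
    Φ.ddown.splitSeq i / headProd Φ.thetaStar i =
      ∑ h ∈ Finset.Iic i, B h (i - h) (d - i) *
        (etaPoly Φ.theta (i - h)).eval (Φ.theta 0) * Φ.splitSeq h / headProd Φ.thetaStar h := by
  have h1 : Φ.Es 0 * aeval Φ.A (tauPoly (fun j => Φ.theta j.rev) i) * Φ.Es 0 =
      (Φ.ddown.splitSeq i / headProd Φ.thetaStar i) • Φ.Es 0 := hΦ.ddown.Es_mul_tauPoly_mul_Es i
  rw [tauPoly_rev, etaPoly_eq_sum hB Φ.theta_injective (by omega),
    ← sum_Iic_eq_sum_range (fun h => C (B h (i - h) (d - i) *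
      (etaPoly Φ.theta (i - h)).eval (Φ.theta 0)) * tauPoly Φ.theta h), map_sum, Finset.mul_sum,
    Finset.sum_mul] at h1
  simp only [map_mul, aeval_C, ← Algebra.smul_def, mul_smul_comm, smul_mul_assoc,
    hΦ.Es_mul_tauPoly_mul_Es, smul_smul, ← Finset.sum_smul] at h1
  have hne : Φ.Es 0 ≠ 0 := Φ.star.E_ne_zero 0
  rw [← smul_left_injective K hne h1]
  refine Finset.sum_congr rfl fun h _ => ?_
  rw [mul_div_assoc]

theorem ddown_ddown (Φ : TDSystem K V d) : Φ.ddown.ddown = Φ := by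
  obtain ⟨A, E, As, Es, _, _, _⟩ := Φ
  simp [ddown]

theorem IsSharp.splitSeq_div [FiniteDimensional K V] (hΦ : Φ.IsSharp)
    {B : ℕ → ℕ → ℕ → K} (hB : IsPascalBracket d (seqExt fun j => Φ.theta j.rev) B)
    (i : Fin (d + 1)) :
    Φ.splitSeq i / headProd Φ.thetaStar i =
      ∑ h ∈ Finset.Iic i, B h (i - h) (d - i) *
        (tauPoly Φ.theta (i - h)).eval (Φ.theta (Fin.last d)) * Φ.ddown.splitSeq h /
          headProd Φ.thetaStar h := by
  have h := hΦ.ddown.ddown_splitSeq_div hB i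
  rw [ddown_ddown, show Φ.ddown.theta = fun j => Φ.theta j.rev from rfl,
    show Φ.ddown.thetaStar = Φ.thetaStar from rfl] at h
  simpa only [etaPoly_rev, Fin.rev_zero] using h

theorem IsBase.isRecurrentSeq {q : AlgebraicClosure K} (h : Φ.IsBase q) :
    IsRecurrentSeq d (q + q⁻¹ + 1)
      (fun n => algebraMap K (AlgebraicClosure K) (seqExt Φ.theta n)) :=
  isRecurrentSeq_seqExt Φ.theta_injective fun k hk => (h.2 k hk).1

theorem IsBase.star {q : AlgebraicClosure K} (h : Φ.IsBase q) : Φ.star.IsBase q :=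
  ⟨h.1, fun k hk => (h.2 k hk).symm⟩

theorem IsBase.exists_bracket {q : AlgebraicClosure K} (h : Φ.IsBase q) :
    ∃ br : ℕ → ℕ → ℕ → K, ∀ r s t, r + s + t ≤ d →
      algebraMap K (AlgebraicClosure K) (br r s t) = qBracket q r s t := by
  have hB := isPascalBracket_qBracket h.isRecurrentSeq h.1
  have hinj : ∀ i j, i ≤ d → j ≤ d → seqExt Φ.theta i = seqExt Φ.theta j → i = j :=
    fun i j hi hj e => by
      by_contra hne
      exact Φ.seqExt_theta_ne hi hj hne e
  have : ∀ r s t, ∃ x : K, r + s + t ≤ d →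
      algebraMap K (AlgebraicClosure K) x = qBracket q r s t := fun r s t => by
    by_cases hd : r + s + t ≤ d
    · obtain ⟨x, hx⟩ := hB.exists_algebraMap_eq hinj r s t hd
      exact ⟨x, fun _ => hx⟩
    · exact ⟨0, fun h => absurd h hd⟩
  choose br hbr using this
  exact ⟨br, hbr⟩

variable {q : AlgebraicClosure K} {br : ℕ → ℕ → ℕ → K}

theorem IsBase.isPascalBracket (h : Φ.IsBase q) (hbr : ∀ r s t, r + s + t ≤ d →
      algebraMap K (AlgebraicClosure K) (br r s t) = qBracket q r s t) :
    IsPascalBracket d (seqExt Φ.theta) br :=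
  (isPascalBracket_qBracket h.isRecurrentSeq h.1).of_algebraMap hbr

theorem IsBase.isPascalBracket_rev (h : Φ.IsBase q) (hbr : ∀ r s t, r + s + t ≤ d →
      algebraMap K (AlgebraicClosure K) (br r s t) = qBracket q r s t) :
    IsPascalBracket d (seqExt fun j => Φ.theta j.rev) br :=
  (isPascalBracket_qBracket h.isRecurrentSeq.rev h.1).of_algebraMap hbr

variable [FiniteDimensional K V]

/-- The formula for $\Downarrow$ applied to $\Phi^*$: the system $\Phi^{*\Downarrow}$ is
$\Phi^{\downarrow *}$, and `*` leaves split sequences unchanged. -/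
theorem IsSharp.down_splitSeq_div (hΦ : Φ.IsSharp)
    (hB : IsPascalBracket d (seqExt Φ.thetaStar) br) (i : Fin (d + 1)) :
    Φ.down.splitSeq i / headProd Φ.theta i =
      ∑ h ∈ Finset.Iic i, br h (i - h) (d - i) *
        (etaPoly Φ.thetaStar (i - h)).eval (Φ.thetaStar 0) * Φ.splitSeq h /
          headProd Φ.theta h := by
  have key := hΦ.star.ddown_splitSeq_div hB i
  rw [show Φ.star.ddown.splitSeq = Φ.down.splitSeq from hΦ.down.splitSeq_star,
    hΦ.splitSeq_star] at key
  exact key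

theorem IsSharp.splitSeq_div_star (hΦ : Φ.IsSharp)
    (hB : IsPascalBracket d (seqExt fun j => Φ.thetaStar j.rev) br) (i : Fin (d + 1)) :
    Φ.splitSeq i / headProd Φ.theta i =
      ∑ h ∈ Finset.Iic i, br h (i - h) (d - i) *
        (tauPoly Φ.thetaStar (i - h)).eval (Φ.thetaStar (Fin.last d)) * Φ.down.splitSeq h /
          headProd Φ.theta h := by
  have key := hΦ.star.splitSeq_div hB i
  rw [show Φ.star.ddown.splitSeq = Φ.down.splitSeq from hΦ.down.splitSeq_star,
    hΦ.splitSeq_star] at key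
  exact key

theorem IsSharp.splitSeq_relative (hΦ : Φ.IsSharp) (a b c : Bool) :
    (Φ.relative a b c).splitSeq = (Φ.relative a b false).splitSeq := by
  cases c
  · rfl
  · exact (hΦ.relative a b false).splitSeq_star

variable {V' : Type*} [AddCommGroup V'] [Module K V'] [FiniteDimensional K V']

theorem IsSharp.ddown_splitSeq_congr (hΦ : Φ.IsSharp) {Φ' : TDSystem K V' d} (hΦ' : Φ'.IsSharp)
    (hB : IsPascalBracket d (seqExt Φ.theta) br) (hθ : Φ'.theta = Φ.theta)
    (hθs : Φ'.thetaStar = Φ.thetaStar) (hζ : Φ'.splitSeq = Φ.splitSeq) :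
    Φ'.ddown.splitSeq = Φ.ddown.splitSeq := by
  funext i
  have h1 := hΦ.ddown_splitSeq_div hB i
  have h2 := hΦ'.ddown_splitSeq_div (hθ.symm ▸ hB) i
  rw [hθ, hθs, hζ, ← h1] at h2
  exact (div_left_inj' (headProd_ne_zero Φ.thetaStar_injective i)).1 h2

theorem IsSharp.down_splitSeq_congr (hΦ : Φ.IsSharp) {Φ' : TDSystem K V' d} (hΦ' : Φ'.IsSharp)
    (hB : IsPascalBracket d (seqExt Φ.thetaStar) br) (hθ : Φ'.theta = Φ.theta)
    (hθs : Φ'.thetaStar = Φ.thetaStar) (hζ : Φ'.splitSeq = Φ.splitSeq) :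
    Φ'.down.splitSeq = Φ.down.splitSeq := by
  funext i
  have h1 := hΦ.down_splitSeq_div hB i
  have h2 := hΦ'.down_splitSeq_div (hθs.symm ▸ hB) i
  rw [hθ, hθs, hζ, ← h1] at h2
  exact (div_left_inj' (headProd_ne_zero Φ.theta_injective i)).1 h2

/-- The brackets built for $\Phi$ also serve $\Phi'$, since the Pascal recursion involves only the
eigenvalue sequences. The formulas then carry equality of split sequences through $\downarrow$ and
$\Downarrow$, and `*` changes nothing. -/
theorem IsSharp.relative_splitSeq_congr (hΦ : Φ.IsSharp) {Φ' : TDSystem K V' d}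
    (hΦ' : Φ'.IsSharp) (h : Φ'.parameterArray = Φ.parameterArray) (a b c : Bool) :
    (Φ'.relative a b c).splitSeq = (Φ.relative a b c).splitSeq := by
  obtain ⟨q, hq⟩ := Φ.exists_isBase
  obtain ⟨br, hbr⟩ := hq.exists_bracket
  have hB := hq.isPascalBracket hbr
  have hBs : IsPascalBracket d (seqExt Φ.thetaStar) br := hq.star.isPascalBracket hbr
  have hθ : Φ'.theta = Φ.theta := congrArg Prod.fst h
  have hθs : Φ'.thetaStar = Φ.thetaStar := congrArg (fun x => x.2.1) h
  have hζ : Φ'.splitSeq = Φ.splitSeq := congrArg (fun x => x.2.2) h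
  have hdown := hΦ.down_splitSeq_congr hΦ' hBs hθ hθs hζ
  have hθs' : Φ'.down.thetaStar = Φ.down.thetaStar := funext fun i => congrFun hθs i.rev
  rw [hΦ.splitSeq_relative, hΦ'.splitSeq_relative]
  cases a <;> cases b
  · exact hζ
  · exact hΦ.ddown_splitSeq_congr hΦ' hB hθ hθs hζ
  · exact hdown
  · exact hΦ.down.ddown_splitSeq_congr hΦ'.down hB hθ hθs' hdown

end Transition

end TDSystem

theorem mainTheorem7 {K : Type*} {V : Type*} [Field K] [AddCommGroup V] [Module K V]
    [FiniteDimensional K V] [Nontrivial V] {d : ℕ} (Φ : TDSystem K V d) (hΦ : Φ.IsSharp) :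
    -- the split sequence of every relative is well defined
    (∀ a b c : Bool, Module.finrank K ((Φ.relative a b c).splitSpace 0) = 1 ∧
      ∀ i, (Φ.relative a b c).IsSplitEigenvalue i ((Φ.relative a b c).splitSeq i)) ∧
    -- a scalar `q` as required exists
    (∃ q, Φ.IsBase q) ∧
    -- for each such `q` the scalars `[r, s, t]_q` lie in `K`, and the relations hold
    (∀ q : AlgebraicClosure K, Φ.IsBase q → ∃ br : ℕ → ℕ → ℕ → K,
      (∀ r s t : ℕ, r + s + t ≤ d →
        algebraMap K (AlgebraicClosure K) (br r s t) = qBracket q r s t) ∧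
      ∀ i : Fin (d + 1),
        -- (i)
        (Φ.down.splitSeq i / headProd Φ.theta i =
          ∑ h ∈ Finset.Iic i, br h (i - h) (d - i) *
            (etaPoly Φ.thetaStar (i - h)).eval (Φ.thetaStar 0) * Φ.splitSeq h /
              headProd Φ.theta h) ∧
        (Φ.splitSeq i / headProd Φ.theta i =
          ∑ h ∈ Finset.Iic i, br h (i - h) (d - i) *
            (tauPoly Φ.thetaStar (i - h)).eval (Φ.thetaStar (Fin.last d)) * Φ.down.splitSeq h /
              headProd Φ.theta h) ∧
        -- (ii)
        (Φ.ddown.splitSeq i / headProd Φ.thetaStar i =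
          ∑ h ∈ Finset.Iic i, br h (i - h) (d - i) *
            (etaPoly Φ.theta (i - h)).eval (Φ.theta 0) * Φ.splitSeq h /
              headProd Φ.thetaStar h) ∧
        (Φ.splitSeq i / headProd Φ.thetaStar i =
          ∑ h ∈ Finset.Iic i, br h (i - h) (d - i) *
            (tauPoly Φ.theta (i - h)).eval (Φ.theta (Fin.last d)) * Φ.ddown.splitSeq h /
              headProd Φ.thetaStar h) ∧
        -- (iii)
        (Φ.down.ddown.splitSeq i / tailProd Φ.thetaStar i =
          ∑ h ∈ Finset.Iic i, br h (i - h) (d - i) *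
            (etaPoly Φ.theta (i - h)).eval (Φ.theta 0) * Φ.down.splitSeq h /
              tailProd Φ.thetaStar h) ∧
        (Φ.down.splitSeq i / tailProd Φ.thetaStar i =
          ∑ h ∈ Finset.Iic i, br h (i - h) (d - i) *
            (tauPoly Φ.theta (i - h)).eval (Φ.theta (Fin.last d)) * Φ.down.ddown.splitSeq h /
              tailProd Φ.thetaStar h) ∧
        -- (iv)
        (Φ.down.ddown.splitSeq i / tailProd Φ.theta i =
          ∑ h ∈ Finset.Iic i, br h (i - h) (d - i) *
            (etaPoly Φ.thetaStar (i - h)).eval (Φ.thetaStar 0) * Φ.ddown.splitSeq h /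
              tailProd Φ.theta h) ∧
        (Φ.ddown.splitSeq i / tailProd Φ.theta i =
          ∑ h ∈ Finset.Iic i, br h (i - h) (d - i) *
            (tauPoly Φ.thetaStar (i - h)).eval (Φ.thetaStar (Fin.last d)) *
              Φ.down.ddown.splitSeq h / tailProd Φ.theta h)) ∧
    -- the split sequence of every relative is determined by the parameter array
    (∀ (V' : Type*) [AddCommGroup V'] [Module K V'] [FiniteDimensional K V'] [Nontrivial V']
      (Φ' : TDSystem K V' d), Φ'.IsSharp → Φ'.parameterArray = Φ.parameterArray →
        ∀ a b c : Bool, (Φ'.relative a b c).splitSeq = (Φ.relative a b c).splitSeq) := by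
  refine ⟨fun a b c => ⟨?_, (hΦ.relative a b c).isSplitEigenvalue_splitSeq⟩, Φ.exists_isBase,
    fun q hq => ?_, fun V' _ _ _ _ Φ' hΦ' h => hΦ.relative_splitSeq_congr hΦ' h⟩
  -- $U_0$ equals $E^*_0V$, so its dimension is 1 by sharpness of the dual system.
  · rw [TDSystem.splitSpace_zero]
    exact (hΦ.relative a b c).star
  obtain ⟨br, hbr⟩ := hq.exists_bracket
  have hB := hq.isPascalBracket hbr
  have hBr := hq.isPascalBracket_rev hbr
  have hBs : IsPascalBracket d (seqExt Φ.thetaStar) br := hq.star.isPascalBracket hbr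
  have hBsr : IsPascalBracket d (seqExt fun j => Φ.thetaStar j.rev) br :=
    hq.star.isPascalBracket_rev hbr
  -- Under reversal the denominators of (ii) for $\Phi^{\downarrow}$ and of (i) for
  -- $\Phi^{\Downarrow}$ become those of (iii) and (iv).
  have htail : ∀ n : ℕ, headProd Φ.ddown.theta n = tailProd Φ.theta n := headProd_rev Φ.theta
  have htail' : ∀ n : ℕ, headProd Φ.down.thetaStar n = tailProd Φ.thetaStar n :=
    headProd_rev Φ.thetaStar
  refine ⟨br, hbr, fun i => ⟨hΦ.down_splitSeq_div hBs i, hΦ.splitSeq_div_star hBsr i,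
    hΦ.ddown_splitSeq_div hB i, hΦ.splitSeq_div hBr i, ?_, ?_, ?_, ?_⟩⟩
  · have h := hΦ.down.ddown_splitSeq_div hB i
    simp only [htail'] at h
    exact h
  · have h := hΦ.down.splitSeq_div hBr i
    simp only [htail'] at h
    exact h
  · have h := hΦ.ddown.down_splitSeq_div hBs i
    simp only [htail] at h
    exact h
  · have h := hΦ.ddown.splitSeq_div_star hBsr i
    simp only [htail] at h
    exact h
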